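/- Work over $\mathbb C$. Let $S\subset\mathbb N$ be a numerical semigroup with $g:=\#(\mathbb N\setminus S)>0$ and conductor $c$ (the least integer such that every $r\ge c$ lies in $S$), let $\rho(s):=\#\{r>s: r\notin S\}$, and let $0=k_0<k_1<\dots<k_n$ be integers, $\mathbf k=(k_0,\dots,k_n)$. Let $d\ge\max(n,2g-2)$. Let $M^n_d$ be the space of nondegenerate degree-$d$ morphisms $f:\mathbb P^1\to\mathbb P^n$, each identified with the coefficients of its $n+1$ parameterizing binary forms of degree $d$ (so $M^n_d$ is an open subset of $\mathbb A^{(n+1)(d+1)}$). Let $\mathcal V_{\mathbf k}\subset M^n_d$ be the set of those $f$ for which $f$ is injective and there is a point $P\in\mathbb P^1$ such that the image is smooth away from $f(P)$, the value semigroup at $f(P)$ (the set of valuations in a local parameter $t$ at $P$ of nonzero elements of the image of $\mathbb C[[x_1,\dots,x_n]]$ under $x_i\mapsto f_i(t)$, where the $f_i$ are the pullbacks of affine coordinates centred at $f(P)$) equals $S$, and the vanishing orders at $P$ of the nonzero linear combinations of the parameterizing forms are exactly $k_0,\dots,k_n$. A decomposition of $s\in\mathbb N$ is a vector $(m_1,\dots,m_n)\in\mathbb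 N^n$ with $s=m_1k_1+\dots+m_nk_n$. It is reducible if some proper sub-sum of the right-hand side has another decomposition with respect to $k_1,\dots,k_n$, and irreducible otherwise. For each $s$ let $I(s)$ be the set of irreducible decompositions of $s$. (The theorem also holds if, for every $s$, $I(s)$ is instead any set of decompositions of $s$ containing exactly one from each class of the equivalence relation generated by replacing a proper sub-sum of a decomposition by another decomposition of the same number.) Put $\psi(s)=\#I(s)$, $\varphi(s)=\max(\psi(s)-1,0)$, and for each $s$ with $I(s)\ne\emptyset$ fix any $v_{s,1}\in I(s)$. Let $E\subset\mathbb Q^n$ be the finite set of all differences $v-v_{s,1}$, where $s\in S$, $0<s<c$, and $v\in I(s)\setminus\{v_{s,1}\}$. Let $C_1,\dots,C_q$ be the circuits (minimal linearly dependent subsets) of the vector matroid on $E$, and let $s(i)$ be the largest $s\in S$ with $0<s<c$ such that $C_i$ contains a difference $v-v_{s,1}$ with $v\in I(s)\setminus\{v_{s,1}\}$. Put $D(\mathbf k)=\sum_{i=1}^q\rho(s(i))$. Let $s_1^*<\dots<s_\ell^*$ be the minimal generators of $S$ that are less than $c$ and are not entries of $\mathbf k$, and let $m=\min\bigl(\ell,\sum_{s\in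 S}\varphi(s)\bigr)$. **Theorem.** If $\mathcal V_{\mathbf k}$ is nonempty, then $$\operatorname{cod}(\mathcal V_{\mathbf k},M^n_d)\ \ge\ \sum_{i=1}^n(k_i-i)+\sum_{s\in S,\ 1\le s\le 2g}\varphi(s)\rho(s)-\sum_{i=1}^m\rho(s_i^*)-D(\mathbf k)-1,$$ where the codimension is that of the Zariski closure (the minimum over its irreducible components). -/

import Mathlib

open scoped Classical PowerSeries

noncomputable section

namespace Severi

/-! ### Numerical semigroups -/

/-- The number of gaps of `S`. -/
def genus (S : AddSubmonoid ℕ) : ℕ := {r : ℕ | r ∉ S}.ncard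

/-- The conductor: the least `c` such that every integer `≥ c` lies in `S`. -/
def conductor (S : AddSubmonoid ℕ) : ℕ := sInf {c : ℕ | ∀ r, c ≤ r → r ∈ S}

/-- `ρ(s)` is the number of gaps of `S` greater than `s`. -/
def rho (S : AddSubmonoid ℕ) (s : ℕ) : ℕ := {r : ℕ | s < r ∧ r ∉ S}.ncard

/-- Minimal generators of `S`: nonzero elements that are not sums of two nonzero elements. -/
def IsMinimalGenerator (S : AddSubmonoid ℕ) (s : ℕ) : Prop :=
  s ∈ S ∧ s ≠ 0 ∧ ∀ a ∈ S, ∀ b ∈ S, a + b = s → a = 0 ∨ b = 0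

section Curves

variable {n d : ℕ}

/-! ### Morphisms from the projective line

A tuple of `n + 1` binary forms of degree `d` is given by its coefficients
`a (i, j)`, `i ≤ n`, `j ≤ d`; points of the projective line are given by nonzero vectors of `ℂ²`. -/

/-- The value at `(u, v)` of the `i`-th form `∑ j, a (i, j) u ^ j v ^ (d - j)`. -/
def evalForm {A : Type} [CommRing A] [Algebra ℂ A] (a : Fin (n + 1) × Fin (d + 1) → ℂ)
    (i : Fin (n + 1)) (u v : A) : A :=
  ∑ j : Fin (d + 1), algebraMap ℂ A (a (i, j)) * u ^ (j : ℕ) * v ^ (d - (j : ℕ))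

/-- Two vectors of `ℂ²` that are linearly independent (for nonzero vectors: distinct points of the
projective line). -/
def Indep (P Q : Fin 2 → ℂ) : Prop := P 0 * Q 1 - P 1 * Q 0 ≠ 0

/-- `M^n_d`: coefficients of `n + 1` linearly independent binary forms of degree `d` without
common zero, i.e. of the nondegenerate morphisms `ℙ¹ → ℙⁿ` of degree `d`. -/
def mappingSpace (n d : ℕ) : Set (Fin (n + 1) × Fin (d + 1) → ℂ) :=
  {a | LinearIndependent ℂ (fun (i : Fin (n + 1)) (j : Fin (d + 1)) => a (i, j)) ∧
    ∀ P : Fin 2 → ℂ, P ≠ 0 → ∃ i, evalForm a i (P 0) (P 1) ≠ 0}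

/-- Injectivity of the morphism on points: if the image vectors of `P` and `Q` are proportional,
then so are `P` and `Q`. -/
def InjectiveOnPoints (a : Fin (n + 1) × Fin (d + 1) → ℂ) : Prop :=
  ∀ P Q : Fin 2 → ℂ, Indep P Q →
    ∃ i j, evalForm a i (P 0) (P 1) * evalForm a j (Q 0) (Q 1) ≠
      evalForm a j (P 0) (P 1) * evalForm a i (Q 0) (Q 1)

/-- The `i`-th form along `t ↦ P + t Q`; if `Q` is independent of `P`, then `t` is a
local parameter of the projective line at `P`. -/
def localSection (a : Fin (n + 1) × Fin (d + 1) → ℂ) (P Q : Fin 2 → ℂ) (i : Fin (n + 1)) : ℂ⟦X⟧ :=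
  evalForm a i (PowerSeries.C (P 0) + PowerSeries.C (Q 0) * PowerSeries.X)
    (PowerSeries.C (P 1) + PowerSeries.C (Q 1) * PowerSeries.X)

/-- The pullbacks `F_i / F_j - (F_i / F_j)(P)` of the affine coordinates of `ℙⁿ` centred at the
image of `P`, in the chart where the `j`-th coordinate is nonzero (it is `0` for `i = j`). -/
def localCoordinate (a : Fin (n + 1) × Fin (d + 1) → ℂ) (P Q : Fin 2 → ℂ) (j i : Fin (n + 1)) :
    ℂ⟦X⟧ :=
  localSection a P Q i * (localSection a P Q j)⁻¹ -
    PowerSeries.C (PowerSeries.constantCoeff (localSection a P Q i * (localSection a P Q j)⁻¹))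

/-- The set of `t`-adic valuations of the nonzero elements of the image of the ring of formal
power series in the affine coordinates at the image of `P`, under substitution of their pullbacks.
It does not depend on the chart `j` nor on the local parameter (given by `Q`). -/
def valueSet (a : Fin (n + 1) × Fin (d + 1) → ℂ) (P : Fin 2 → ℂ) : Set ℕ :=
  {s | ∃ (Q : Fin 2 → ℂ) (j : Fin (n + 1)) (G : MvPowerSeries (Fin (n + 1)) ℂ),
    Indep P Q ∧ evalForm a j (P 0) (P 1) ≠ 0 ∧
    PowerSeries.order (MvPowerSeries.subst (localCoordinate a P Q j) G : ℂ⟦X⟧) = (s : ℕ∞)}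

/-- The set of vanishing orders at `P` of the nonzero linear combinations of the forms. -/
def vanishingOrders (a : Fin (n + 1) × Fin (d + 1) → ℂ) (P : Fin 2 → ℂ) : Set ℕ :=
  {s | ∃ (Q : Fin 2 → ℂ) (c : Fin (n + 1) → ℂ), Indep P Q ∧
    PowerSeries.order (∑ i, c i • localSection a P Q i) = (s : ℕ∞)}

/-- The stratum `V_k`: morphisms that are injective on points (every point of the image is
unibranch), with value semigroup `S` and vanishing orders `k 0 < ⋯ < k n` at one point `P`, the
image being smooth (value semigroup `ℕ`) at the images of all other points. -/
def stratum (d : ℕ) (S : AddSubmonoid ℕ) (k : Fin (n + 1) → ℕ) :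
    Set (Fin (n + 1) × Fin (d + 1) → ℂ) :=
  {a | a ∈ mappingSpace n d ∧ InjectiveOnPoints a ∧
    ∃ P : Fin 2 → ℂ, P ≠ 0 ∧ valueSet a P = (S : Set ℕ) ∧ vanishingOrders a P = Set.range k ∧
      ∀ R : Fin 2 → ℂ, Indep P R → valueSet a R = Set.univ}

/-- The codimension of (the Zariski closure of) a subset of an affine space: the height of its
vanishing ideal, i.e. the least codimension of an irreducible component of the closure.
As `mappingSpace n d` is Zariski open in affine space, this is the codimension in it of a
nonempty subset of it. -/
def codim {σ : Type} (Z : Set (σ → ℂ)) : ℕ∞ := (MvPolynomial.vanishingIdeal ℂ Z).height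

end Curves

section Decompositions

variable {n : ℕ}

/-! ### Decompositions

Here `k 0 = 0` and the parts are `k 1 < ⋯ < k n`; exponent vectors `v : Fin n → ℕ` are indexed so
that `v i` is the multiplicity of the part `k i.succ`. -/

/-- The sum `∑ m_i k_i`. -/
def value (k : Fin (n + 1) → ℕ) (v : Fin n → ℕ) : ℕ := ∑ i, v i * k i.succ

/-- The decompositions of `s` (when the parts are positive, all multiplicities are `≤ s`). -/
def decompositions (k : Fin (n + 1) → ℕ) (s : ℕ) : Finset (Fin n → ℕ) :=
  (Fintype.piFinset fun _ => Finset.range (s + 1)).filter fun v => value k v = s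

/-- `w` arises from `v` by replacing a proper sub-sum `u` of `v` by a decomposition `u'` of the
same number. -/
def Trade (k : Fin (n + 1) → ℕ) (v w : Fin n → ℕ) : Prop :=
  ∃ u u' r : Fin n → ℕ, r ≠ 0 ∧ v = u + r ∧ w = u' + r ∧ value k u = value k u'

/-- A decomposition is reducible if some proper sub-sum of it decomposes in another way. -/
def Reducible (k : Fin (n + 1) → ℕ) (v : Fin n → ℕ) : Prop :=
  ∃ u u' r : Fin n → ℕ, r ≠ 0 ∧ v = u + r ∧ u' ≠ u ∧ value k u = value k u'

/-- The irreducible decompositions of `s`. -/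
def irreducibleDecompositions (k : Fin (n + 1) → ℕ) (s : ℕ) : Finset (Fin n → ℕ) :=
  (decompositions k s).filter fun v => ¬ Reducible k v

/-- `I s` contains exactly one decomposition of `s` from each class of decompositions that can
be transformed into each other by successive replacements of proper sub-sums. -/
def IsSystemOfRepresentatives (k : Fin (n + 1) → ℕ) (I : ℕ → Finset (Fin n → ℕ)) : Prop :=
  ∀ s, I s ⊆ decompositions k s ∧
    ∀ v ∈ decompositions k s, ∃! w, w ∈ I s ∧ Relation.ReflTransGen (Trade k) v w

/-! ### The expected codimension

`I s` is the set of decompositions of `s` that are counted and `ref s ∈ I s` is the reference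
decomposition of `s`. -/

/-- `φ(s) = max(ψ(s) - 1, 0)`, where `ψ(s)` is the number of elements of `I s`. -/
def phi (I : ℕ → Finset (Fin n → ℕ)) (s : ℕ) : ℕ := (I s).card - 1

/-- The difference of two exponent vectors. -/
def diff (v w : Fin n → ℕ) : Fin n → ℚ := fun i => (v i : ℚ) - (w i : ℚ)

/-- The differences `v - ref s` for `v ∈ I s`, `v ≠ ref s`. -/
def columnVectors (I : ℕ → Finset (Fin n → ℕ)) (ref : ℕ → Fin n → ℕ) (s : ℕ) :
    Finset (Fin n → ℚ) :=
  ((I s).erase (ref s)).image fun v => diff v (ref s)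

/-- The nonzero elements of `S` less than the conductor. -/
def smallElements (S : AddSubmonoid ℕ) : Finset ℕ :=
  (Finset.range (conductor S)).filter fun s => s ∈ S ∧ s ≠ 0

/-- The ground set `E` of the vector matroid. -/
def groundSet (S : AddSubmonoid ℕ) (I : ℕ → Finset (Fin n → ℕ)) (ref : ℕ → Fin n → ℕ) :
    Finset (Fin n → ℚ) :=
  (smallElements S).biUnion (columnVectors I ref)

/-- The circuits of the vector matroid on `E`: the minimal linearly dependent subsets of `E`. -/
def circuits (S : AddSubmonoid ℕ) (I : ℕ → Finset (Fin n → ℕ)) (ref : ℕ → Fin n → ℕ) :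
    Finset (Finset (Fin n → ℚ)) :=
  (groundSet S I ref).powerset.filter fun C =>
    ¬ LinearIndepOn ℚ id (C : Set (Fin n → ℚ)) ∧
      ∀ C' : Finset (Fin n → ℚ), C' ⊂ C → LinearIndepOn ℚ id (C' : Set (Fin n → ℚ))

/-- The largest `s` among the nonzero elements of `S` below the conductor for which `C` contains
one of the differences attached to `s`. -/
def topElement (S : AddSubmonoid ℕ) (I : ℕ → Finset (Fin n → ℕ)) (ref : ℕ → Fin n → ℕ)
    (C : Finset (Fin n → ℚ)) : ℕ :=
  ((smallElements S).filter fun s => (columnVectors I ref s ∩ C).Nonempty).sup id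

/-- The syzygetic defect `D(k)`. -/
def syzygeticDefect (S : AddSubmonoid ℕ) (I : ℕ → Finset (Fin n → ℕ)) (ref : ℕ → Fin n → ℕ) : ℕ :=
  ∑ C ∈ circuits S I ref, rho S (topElement S I ref C)

/-- The minimal generators of `S` less than the conductor that are not entries of `k`. -/
def missingGenerators (S : AddSubmonoid ℕ) (k : Fin (n + 1) → ℕ) : Finset ℕ :=
  (Finset.range (conductor S)).filter fun s => IsMinimalGenerator S s ∧ s ∉ Set.range k

/-- `m = min(ℓ, ∑_{s ∈ S} φ(s))`, where `ℓ` is the number of missing generators; only finitely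
many `φ(s)` are nonzero. -/
def correctionLength (S : AddSubmonoid ℕ) (k : Fin (n + 1) → ℕ) (I : ℕ → Finset (Fin n → ℕ)) : ℕ :=
  min (missingGenerators S k).card (∑ᶠ s ∈ S, phi I s)

/-- `∑_{i ≤ m} ρ(s*_i)`, where `s*_1 < s*_2 < ⋯` are the missing generators. -/
def generatorCorrection (S : AddSubmonoid ℕ) (k : Fin (n + 1) → ℕ)
    (I : ℕ → Finset (Fin n → ℕ)) : ℕ :=
  ((((missingGenerators S k).sort (· ≤ ·)).take (correctionLength S k I)).map (rho S)).sum

/-- `∑ (k_i - i) + ∑_{s ∈ S ∩ [2g]} φ(s) ρ(s) - ∑_{i ≤ m} ρ(s*_i) - D(k) - 1`. -/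
def expectedCodim (S : AddSubmonoid ℕ) (k : Fin (n + 1) → ℕ) (I : ℕ → Finset (Fin n → ℕ))
    (ref : ℕ → Fin n → ℕ) : ℤ :=
  (∑ i : Fin n, ((k i.succ : ℤ) - ((i : ℤ) + 1)))
    + (∑ s ∈ (Finset.Icc 1 (2 * genus S)).filter (· ∈ S), ((phi I s * rho S s : ℕ) : ℤ))
    - (generatorCorrection S k I : ℤ) - (syzygeticDefect S I ref : ℤ) - 1

end Decompositions

end Severi

end

/-! The bound is a count of parameters. By `card_le_codim_add`, if over every residue field of the
ring of all functions `Z → ℂ` the coordinates lie in a field generated over `ℂ` by at most `M`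
elements, then every component of the closure of `Z` has codimension at least the number of
coordinates minus `M`. Since arbitrary functions are admitted, the data attached to a point of `Z`
may be chosen pointwise, with nothing algebraic to check: polynomial identities between them survive
in the residue field (`familyMap`).

For a morphism in the stratum, take a reduced echelon basis `F 0, …, F n` of the sections at the
distinguished point, with orders `k l`. The morphism is recovered from the point (one parameter),
the change of basis (`(n+1)²` parameters) and the coefficients of the `F l` at the positions not
fixed by the echelon form. This alone gives `∑ (k_i - i) - 1`.

The semigroup imposes further relations. Write `f_i = F_i / F_0 = t^{k_i} u_i`. If `v` and `v'`
decompose the same `s`, then `f^v - f^{v'}` has order greater than `s` and lies in a ring all of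
whose orders are in `S`; so, modulo a power `t^q`, it is a combination of chosen elements of orders
`u ∈ S`, `u > s`. Comparing coefficients at a gap `s + j < q` expresses `∑ (v_i - v'_i) u_{i,j}`
through data of weight less than `j` (`IsNormalForm.coeff_mem`). Hence in each weight `j` one
eliminates as many coefficients as the rank of the differences for which `s + j` is a gap below `q`.
That rank is at least their number minus the number of circuits among them
(`card_le_finrank_add_circuits`); summed over `j`, the circuits contribute at most `D(k)`.

The chosen elements are monomials in the `f_i` and in auxiliary series `G s` for the minimal
generators `s` missing from `k`; the coefficients of `G s` at the gaps above `s` are extra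
parameters. The cutoff `q` limits this cost (`exists_cutoff`): if there are more missing generators
than syzygies allow for, `q` is the first missing generator not to be paid for, and what is lost by
ignoring gaps beyond `q` is covered by the correction term. -/

noncomputable section

namespace Severi

/-! ### Heights of vanishing ideals and transcendence degree. -/

section Height

open MvPolynomial

variable {k L σ : Type} [Field k] [Field L] [Algebra k L]

/-- Evaluation at `x` of the variables in `T` only. -/
def partialEval (x : σ → L) (T : Finset σ) : MvPolynomial σ k →ₐ[k] MvPolynomial σ L :=
  aeval fun i => if i ∈ T then C (x i) else X i

lemma partialEval_insert (x : σ → L) (T : Finset σ) (i : σ) (p : MvPolynomial σ k) :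
    partialEval x (insert i T) p =
      aeval (fun j => if j = i then (C (x i) : MvPolynomial σ L) else X j)
        (partialEval x T p) := by
  induction p using MvPolynomial.induction_on with
  | C a => simp [partialEval, algebraMap_eq, MvPolynomial.algebraMap_apply]
  | add p q hp hq => simp [hp, hq]
  | mul_X p j hp =>
    simp only [map_mul, hp]
    congr 1
    by_cases hj : j = i
    · subst hj
      by_cases hT : j ∈ T <;> simp [partialEval, hT, algebraMap_eq]
    · by_cases hT : j ∈ T <;> simp [partialEval, hT, hj, algebraMap_eq]

lemma partialEval_of_mem_adjoin (x : σ → L) (T : Finset σ) (c : L)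
    (hc : c ∈ Algebra.adjoin k (x '' T)) :
    ∃ p : MvPolynomial σ k, partialEval x T p = C c := by
  induction hc using Algebra.adjoin_induction with
  | mem y hy =>
    obtain ⟨i, hi, rfl⟩ := hy
    exact ⟨X i, by simp [partialEval, Finset.mem_coe.1 hi]⟩
  | algebraMap r => exact ⟨C r, by simp [partialEval, MvPolynomial.algebraMap_apply]⟩
  | add a b _ _ ha hb =>
    obtain ⟨p, hp⟩ := ha
    obtain ⟨q, hq⟩ := hb
    exact ⟨p + q, by simp [hp, hq]⟩
  | mul a b _ _ ha hb =>
    obtain ⟨p, hp⟩ := ha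
    obtain ⟨q, hq⟩ := hb
    exact ⟨p * q, by simp [hp, hq]⟩

/-- An algebraic equation for `x i` over `k[x_T]` lifts to a polynomial that vanishes once `X i` is
evaluated too, but not before. This is one strict step in a chain of primes. -/
lemma ker_partialEval_lt (x : σ → L) (T : Finset σ) (i : σ) (hi : i ∉ T)
    (halg : IsAlgebraic (Algebra.adjoin k (x '' T)) (x i)) :
    RingHom.ker (partialEval (k := k) x T) < RingHom.ker (partialEval (k := k) x (insert i T)) := by
  refine lt_of_le_of_ne (fun p hp => ?_) fun heq => ?_
  · rw [RingHom.mem_ker] at hp ⊢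
    rw [partialEval_insert, hp, map_zero]
  · obtain ⟨f, hf0, hf⟩ := halg
    choose q hq using fun m => partialEval_of_mem_adjoin x T (f.coeff m : L) (f.coeff m).2
    set G : MvPolynomial σ k := ∑ m ∈ Finset.range (f.natDegree + 1), q m * X i ^ m with hG
    have h1 : partialEval x T G =
        ∑ m ∈ Finset.range (f.natDegree + 1), C (f.coeff m : L) * X i ^ m := by
      simp only [hG, map_sum, map_mul, hq, map_pow]
      refine Finset.sum_congr rfl fun m _ => ?_
      simp [partialEval, hi]
    have h2 : partialEval x (insert i T) G = 0 := by
      rw [partialEval_insert, h1]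
      simp only [map_sum, map_mul, map_pow, aeval_X, if_true, algHom_C]
      rw [Polynomial.aeval_eq_sum_range] at hf
      simp only [algebraMap_eq, ← C_mul, ← C_pow, ← map_sum]
      rw [show (∑ m ∈ Finset.range (f.natDegree + 1), (f.coeff m : L) * x i ^ m) = 0 from ?_,
        map_zero]
      simpa [Algebra.smul_def, Subalgebra.smul_def] using hf
    have h3 : partialEval x T G = 0 := by
      have : G ∈ RingHom.ker (partialEval (k := k) x T) := by
        rw [heq]; exact h2
      exact this
    -- Only the variable `X i` occurs in `partialEval x T G`, so sending every variable to `X`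
    -- recovers the equation `f`.
    have h4 : (aeval (fun _ => Polynomial.X : σ → Polynomial L)) (partialEval x T G) =
        f.map (algebraMap _ L) := by
      rw [h1, Polynomial.as_sum_range_C_mul_X_pow (f.map (algebraMap _ L)),
        Polynomial.natDegree_map_eq_of_injective (FaithfulSMul.algebraMap_injective _ _)]
      simp
    rw [h3, map_zero] at h4
    exact hf0 ((Polynomial.map_eq_zero_iff (FaithfulSMul.algebraMap_injective _ _)).1 h4.symm)

/-- The height of the kernel of an evaluation map is at least the codimension computed from the
transcendence degree. -/
theorem card_le_height_ker_add [Fintype σ] {ι : Type} [Fintype ι] (x : σ → L) (y : ι → L)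
    (hxy : ∀ i, x i ∈ IntermediateField.adjoin k (Set.range y)) :
    (Fintype.card σ : ℕ∞) ≤
      (RingHom.ker (aeval x : MvPolynomial σ k →ₐ[k] L)).height + Fintype.card ι := by
  -- `B` is a transcendence basis chosen among the coordinates; `B₀` lists one variable for each of
  -- its members.
  obtain ⟨B, hB⟩ := (AlgebraicIndependent.matroid k L).exists_isBasis (Set.range x)
  rw [AlgebraicIndependent.matroid_isBasis_iff] at hB
  obtain ⟨hBind, hBsub, hBalg⟩ := hB
  have : Finite B := ((Set.finite_range x).subset hBsub).to_subtype
  have : Fintype B := Fintype.ofFinite B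
  choose c hc using fun a : B => hBsub a.2
  set B₀ : Finset σ := Finset.univ.image c with hB₀
  have hB₀B : x '' B₀ = B := by
    ext a
    simp only [hB₀, Finset.coe_image, Finset.coe_univ, Set.image_univ, Set.mem_image,
      Set.mem_range, exists_exists_eq_and, hc]
    exact ⟨fun ⟨b, hb⟩ => hb ▸ b.2, fun ha => ⟨⟨a, ha⟩, rfl⟩⟩
  have hcard : B₀.card ≤ Fintype.card ι := by
    set K := IntermediateField.adjoin k (Set.range y)
    have hBK : ∀ a ∈ B, a ∈ K := fun a ha => by
      rw [← show x (c ⟨a, ha⟩) = a from hc ⟨a, ha⟩]; exact hxy _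
    let b : B → K := fun a => ⟨a, hBK a a.2⟩
    have hb : AlgebraicIndependent k b := by
      rw [← AlgHom.algebraicIndependent_iff K.val K.val.injective]
      exact hBind
    let yK : Set K := Set.range fun i => ⟨y i, IntermediateField.subset_adjoin _ _ ⟨i, rfl⟩⟩
    have h2 : Algebra.IsAlgebraic (Algebra.adjoin k yK) K := by
      have htop : IntermediateField.adjoin k yK = ⊤ := by
        apply IntermediateField.map_injective K.val
        rw [IntermediateField.adjoin_map, ← AlgHom.fieldRange_eq_map, IntermediateField.fieldRange_val]
        congr 1
        ext a
        simp [yK]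
      refine ⟨fun a => ?_⟩
      have ha : a ∈ IntermediateField.adjoin k yK := htop ▸ trivial
      rw [IntermediateField.mem_adjoin_iff_div] at ha
      obtain ⟨r, hr, s, hs, rfl⟩ := ha
      have hr' : IsAlgebraic (Algebra.adjoin k yK) r :=
        isAlgebraic_algebraMap (A := K) (⟨r, hr⟩ : Algebra.adjoin k yK)
      have hs' : IsAlgebraic (Algebra.adjoin k yK) s :=
        isAlgebraic_algebraMap (A := K) (⟨s, hs⟩ : Algebra.adjoin k yK)
      rw [div_eq_mul_inv]
      exact hr'.mul hs'.inv
    have h5 := (hb.cardinalMk_le_trdeg.trans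
      (Algebra.IsAlgebraic.trdeg_le_cardinalMk k yK)).trans Cardinal.mk_range_le
    rw [Cardinal.mk_fintype, Cardinal.mk_fintype, Nat.cast_le] at h5
    exact Finset.card_image_le.trans h5
  -- Evaluating the variables outside `B₀` one after another produces a strictly increasing chain of
  -- primes ending at the full kernel.
  have key : ∀ T : Finset σ, Disjoint T B₀ → (T.card : ℕ∞) ≤
      (RingHom.ker (partialEval (k := k) x (T ∪ B₀))).height := by
    intro T
    induction T using Finset.induction_on with
    | empty => simp
    | insert i T hi ih =>
      intro hd
      rw [Finset.disjoint_insert_left] at hd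
      rw [Finset.card_insert_of_notMem hi, Finset.insert_union, Nat.cast_add, Nat.cast_one]
      have := RingHom.ker_isPrime (partialEval (k := k) x (T ∪ B₀))
      have := RingHom.ker_isPrime (partialEval (k := k) x (insert i (T ∪ B₀)))
      refine (add_le_add_left (ih hd.2) 1).trans
        (Ideal.height_add_one_le_of_lt_of_isPrime
          (ker_partialEval_lt x _ i (by simp [hi, hd.1]) ?_))
      refine (hBalg (x i) ⟨i, rfl⟩).adjoin_of_forall_isAlgebraic fun a ha => absurd ?_ ha.2
      rw [Finset.coe_union, Set.image_union, hB₀B]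
      exact Or.inr ha.1
  have h := key (Finset.univ \ B₀) Finset.sdiff_disjoint
  have hker : RingHom.ker (partialEval (k := k) x (Finset.univ \ B₀ ∪ B₀)) =
      RingHom.ker (aeval x : MvPolynomial σ k →ₐ[k] L) := by
    ext p
    have hp : partialEval x (Finset.univ \ B₀ ∪ B₀) p = C (aeval x p) := by
      rw [partialEval, Finset.sdiff_union_of_subset (Finset.subset_univ _)]
      simp only [Finset.mem_univ, if_true]
      induction p using MvPolynomial.induction_on with
      | C a => simp [MvPolynomial.algebraMap_apply]
      | add p q hp hq => simp [hp, hq]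
      | mul_X p j hp => simp [hp]
    rw [RingHom.mem_ker, RingHom.mem_ker, hp, C_eq_zero]
  rw [hker] at h
  calc (Fintype.card σ : ℕ∞) = ((Finset.univ \ B₀).card : ℕ∞) + B₀.card := by
        rw [← Nat.cast_add, Finset.card_sdiff_add_card_eq_card (Finset.subset_univ _),
          Finset.card_univ]
    _ ≤ _ := add_le_add h (by exact_mod_cast hcard)

/-- To bound the codimension of `Z` from below, it suffices to bound the transcendence degree of
the field generated by the coordinate functions in all residue fields of the ring of all
functions on `Z`. -/
theorem card_le_codim_add [Fintype σ] (Z : Set (σ → ℂ)) (M : ℕ)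
    (h : ∀ (L : Type) [Field L] [Algebra ℂ L] (π : (Z → ℂ) →ₐ[ℂ] L),
      ∃ (ι : Type) (_ : Fintype ι) (y : ι → L), Fintype.card ι ≤ M ∧
        ∀ i, π (fun z => z.1 i) ∈ IntermediateField.adjoin ℂ (Set.range y)) :
    (Fintype.card σ : ℕ∞) ≤ codim Z + M := by
  let Φ : MvPolynomial σ ℂ →ₐ[ℂ] (Z → ℂ) := aeval fun i z => z.1 i
  have hΦ : ∀ p z, Φ p z = aeval z.1 p := fun p z => by
    have : (Pi.evalAlgHom ℂ (fun _ : Z => ℂ) z).comp Φ = aeval z.1 := by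
      ext i; simp [Φ]
    exact DFunLike.congr_fun this p
  have hI : vanishingIdeal ℂ Z = (⊥ : Ideal (Z → ℂ)).comap (Φ : MvPolynomial σ ℂ →+* (Z → ℂ)) := by
    ext p
    simp only [mem_vanishingIdeal_iff, Ideal.mem_comap, Ideal.mem_bot]
    exact ⟨fun hp => funext fun z => (hΦ p z).trans (hp z.1 z.2),
      fun hp z hz => (hΦ p ⟨z, hz⟩).symm.trans (congrFun hp ⟨z, hz⟩)⟩
  rw [codim, Ideal.height_eq_inf_minimalPrimes]
  simp only [ENat.iInf_add]
  refine le_iInf₂ fun J hJ => ?_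
  rw [hI] at hJ
  -- A minimal prime of a contracted ideal is itself contracted, so the residue field at `J` embeds
  -- in one of the ring of all functions.
  obtain ⟨𝔓, h𝔓, -, hcomap⟩ := Ideal.exists_comap_eq_of_mem_minimalPrimes _ J hJ
  let L := FractionRing ((Z → ℂ) ⧸ 𝔓)
  let π : (Z → ℂ) →ₐ[ℂ] L :=
    (IsScalarTower.toAlgHom ℂ ((Z → ℂ) ⧸ 𝔓) L).comp (Ideal.Quotient.mkₐ ℂ 𝔓)
  obtain ⟨ι, _, y, hM, hy⟩ := h L π
  have hker : RingHom.ker (aeval (fun i => π (fun z => z.1 i)) : MvPolynomial σ ℂ →ₐ[ℂ] L) = J := by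
    rw [← hcomap]
    have hcomp : (aeval (fun i => π (fun z => z.1 i)) : MvPolynomial σ ℂ →ₐ[ℂ] L) = π.comp Φ := by
      ext i; simp [Φ]
    ext p
    rw [RingHom.mem_ker, hcomp, Ideal.mem_comap, ← Ideal.Quotient.eq_zero_iff_mem,
      ← (FaithfulSMul.algebraMap_injective ((Z → ℂ) ⧸ 𝔓) L).eq_iff, map_zero]
    rfl
  have := card_le_height_ker_add (k := ℂ) _ y hy
  rw [hker] at this
  exact this.trans (add_le_add_right (by exact_mod_cast hM) _)

/-- A prime containing the ideal of the union contains one of the two ideals. It serves to treat the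
two standard charts separately. -/
lemma le_codim_union {σ : Type} (Z₀ Z₁ : Set (σ → ℂ)) (N : ℕ∞) (M : ℕ)
    (h₀ : N ≤ codim Z₀ + M) (h₁ : N ≤ codim Z₁ + M) : N ≤ codim (Z₀ ∪ Z₁) + M := by
  rw [codim, Ideal.height_eq_inf_minimalPrimes]
  simp only [ENat.iInf_add]
  refine le_iInf₂ fun J hJ => ?_
  have hle : vanishingIdeal ℂ Z₀ ⊓ vanishingIdeal ℂ Z₁ ≤ J := by
    refine le_trans (fun p hp => ?_) hJ.1.2
    rw [Ideal.mem_inf, mem_vanishingIdeal_iff, mem_vanishingIdeal_iff] at hp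
    rw [mem_vanishingIdeal_iff]
    rintro x (hx | hx)
    exacts [hp.1 x hx, hp.2 x hx]
  rcases (Ideal.IsPrime.inf_le hJ.1.1).1 hle with hle | hle
  · exact h₀.trans (add_le_add_left (Ideal.height_mono hle) _)
  · exact h₁.trans (add_le_add_left (Ideal.height_mono hle) _)

end Height

/-! ### Pivots, and nullity versus circuits. -/

section LinearAlgebra

/-- A reduced echelon form: a space of vectors that embeds into the coordinates in `U` has a set
of pivots in `U`. -/
lemma exists_pivots {ι : Type} [Fintype ι] (V : Submodule ℚ (ι → ℚ)) (U : Finset ι)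
    (hU : ∀ v ∈ V, (∀ i ∈ U, v i = 0) → v = 0) :
    ∃ E ⊆ U, E.card = Module.finrank ℚ V ∧
      ∀ i ∈ E, ∃ v ∈ V, v i = 1 ∧ ∀ i' ∈ E, i' ≠ i → v i' = 0 := by
  obtain ⟨E, hE, hmin⟩ := exists_minimal_of_wellFoundedLT
    (fun E : Finset ι => E ⊆ U ∧ ∀ v ∈ V, (∀ i ∈ E, v i = 0) → v = 0) ⟨U, subset_rfl, hU⟩
  have hpiv : ∀ i ∈ E, ∃ v ∈ V, v i = 1 ∧ ∀ i' ∈ E, i' ≠ i → v i' = 0 := by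
    intro i hi
    -- By minimality, `E` without `i` no longer detects all of `V`; a vector that escapes it becomes
    -- the pivot vector of `i` after scaling.
    have : ¬ ∀ v ∈ V, (∀ i' ∈ E.erase i, v i' = 0) → v = 0 := fun h =>
      Finset.notMem_erase i E
        (hmin ⟨(Finset.erase_subset _ _).trans hE.1, h⟩ (Finset.erase_subset _ _) hi)
    push Not at this
    obtain ⟨v, hv, hvE, hv0⟩ := this
    have hvi : v i ≠ 0 := fun h => hv0 (hE.2 v hv fun i' hi' => by
      by_cases h' : i' = i
      · rw [h', h]
      · exact hvE i' (Finset.mem_erase.2 ⟨h', hi'⟩))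
    refine ⟨(v i)⁻¹ • v, V.smul_mem _ hv, by simp [hvi], fun i' hi' hne => ?_⟩
    simp [hvE i' (Finset.mem_erase.2 ⟨hne, hi'⟩)]
  refine ⟨E, hE.1, ?_, hpiv⟩
  choose v hv hv1 hv0 using hpiv
  let ρ : V →ₗ[ℚ] (E → ℚ) := LinearMap.pi fun i => (LinearMap.proj i.1).comp V.subtype
  have hinj : Function.Injective ρ := by
    rw [← LinearMap.ker_eq_bot, LinearMap.ker_eq_bot']
    intro x hx
    exact Subtype.ext (hE.2 x x.2 fun i hi => congrFun hx ⟨i, hi⟩)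
  have hsurj : Function.Surjective ρ := by
    intro y
    refine ⟨∑ i : E, y i • ⟨v i i.2, hv i i.2⟩, ?_⟩
    ext i'
    rw [map_sum, Finset.sum_apply, Finset.sum_eq_single i']
    · simp [ρ, hv1]
    · intro i _ hne
      simp [ρ, hv0 i i.2 i' i'.2 fun h => hne (Subtype.ext h.symm)]
    · simp
  rw [(LinearEquiv.ofBijective ρ ⟨hinj, hsurj⟩).finrank_eq]
  simp

/-- The nullity of a finite set of vectors is at most its number of circuits. -/
lemma card_le_finrank_add_circuits {M : Type} [AddCommGroup M] [Module ℚ M] (E : Finset M) :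
    E.card ≤ Module.finrank ℚ (Submodule.span ℚ (E : Set M)) +
      (E.powerset.filter fun C : Finset M => ¬ LinearIndepOn ℚ id (C : Set M) ∧
        ∀ C' : Finset M, C' ⊂ C → LinearIndepOn ℚ id (C' : Set M)).card := by
  obtain ⟨B, ⟨hBE, hB⟩, hmax⟩ := (E.powerset.filter fun C : Finset M =>
    LinearIndepOn ℚ id (C : Set M)).exists_maximal ⟨∅, by simp⟩ |>.imp fun B h =>
      (⟨by simpa using h.1, h.2⟩ : (B ⊆ E ∧ LinearIndepOn ℚ id (B : Set M)) ∧ _)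
  have hrank : B.card ≤ Module.finrank ℚ (Submodule.span ℚ (E : Set M)) := by
    have h1 : Module.finrank ℚ (Submodule.span ℚ (B : Set M)) = B.card := by
      have := finrank_span_finset_eq_card (R := ℚ) (s := B) hB
      exact this
    rw [← h1]
    exact Submodule.finrank_mono (Submodule.span_mono (by exact_mod_cast hBE))
  -- The fundamental circuit of `e` relative to the basis `B`. It determines `e`, its only member
  -- outside `B`.
  have hcirc : ∀ e ∈ E \ B, ∃ C : Finset M, C ⊆ insert e B ∧ e ∈ C ∧
      ¬ LinearIndepOn ℚ id (C : Set M) ∧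
        ∀ C' : Finset M, C' ⊂ C → LinearIndepOn ℚ id (C' : Set M) := by
    intro e he
    rw [Finset.mem_sdiff] at he
    have hdep : ¬ LinearIndepOn ℚ id ((insert e B : Finset M) : Set M) := fun h =>
      he.2 (hmax (by simp [Finset.insert_subset_iff, he.1, hBE] at h ⊢; exact h)
        (Finset.subset_insert e B) (Finset.mem_insert_self e B))
    obtain ⟨C, hC, hmin⟩ := exists_minimal_of_wellFoundedLT
      (fun C : Finset M => C ⊆ insert e B ∧ ¬ LinearIndepOn ℚ id (C : Set M))
      ⟨_, subset_rfl, hdep⟩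
    refine ⟨C, hC.1, ?_, hC.2, fun C' hC' => ?_⟩
    · by_contra h
      refine hC.2 (hB.mono ?_)
      exact_mod_cast (Finset.subset_insert_iff_of_notMem h).1 hC.1
    · by_contra h
      exact hC'.2 (hmin ⟨hC'.1.trans hC.1, h⟩ hC'.1)
  choose! C hCsub hCmem hC using hcirc
  have hle : (E \ B).card ≤ (E.powerset.filter fun C : Finset M => ¬ LinearIndepOn ℚ id (C : Set M) ∧
        ∀ C' : Finset M, C' ⊂ C → LinearIndepOn ℚ id (C' : Set M)).card := by
    refine Finset.card_le_card_of_injOn C (fun e he => ?_) fun e he e' he' h => ?_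
    · have he2 : e ∈ E \ B := he
      simp only [Finset.coe_filter, Finset.mem_powerset, Set.mem_ofPred_eq]
      exact ⟨(hCsub e he2).trans (Finset.insert_subset (Finset.mem_sdiff.1 he2).1 hBE), hC e he2⟩
    · have h1 : e ∈ C e' := h ▸ hCmem e he
      rcases Finset.mem_insert.1 (hCsub e' he' h1) with h2 | h2
      · exact h2
      · exact absurd h2 (Finset.mem_sdiff.1 he).2
  have := Finset.card_sdiff_add_card_eq_card hBE
  omega

end LinearAlgebra

/-! ### Trades between decompositions. -/

section Decompositions

variable {n : ℕ} {k : Fin (n + 1) → ℕ}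

lemma value_add (v w : Fin n → ℕ) : value k (v + w) = value k v + value k w := by
  simp [value, add_mul, Finset.sum_add_distrib]

lemma value_single (i : Fin n) (m : ℕ) : value k (Pi.single i m) = m * k i.succ := by
  rw [value, Finset.sum_eq_single i] <;> simp +contextual

lemma single_le_of_le {v : Fin n → ℕ} {i : Fin n} {m : ℕ} (h : m ≤ v i) :
    Pi.single i m ≤ v := by
  intro j
  by_cases hj : j = i
  · subst hj; simpa using h
  · simp [hj]

lemma value_eq_of_mem_decompositions {s : ℕ} {v : Fin n → ℕ} (hv : v ∈ decompositions k s) :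
    value k v = s := (Finset.mem_filter.1 hv).2

lemma succ_pos_of_strictMono (hk : StrictMono k) (i : Fin n) : 0 < k i.succ :=
  (Nat.zero_le _).trans_lt (hk (Fin.succ_pos i))

/-- The admissible families of decompositions: no two members of the family decompose the same
number and are linked by trades. -/
def Unlinked (k : Fin (n + 1) → ℕ) (I : ℕ → Finset (Fin n → ℕ)) : Prop :=
  ∀ s, I s ⊆ decompositions k s ∧
    ∀ v ∈ I s, ∀ w ∈ I s, Relation.ReflTransGen (Trade k) v w → v = w

lemma unlinked_irreducibleDecompositions : Unlinked k (irreducibleDecompositions k) := by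
  refine fun s => ⟨Finset.filter_subset _ _, fun v hv w hw h => ?_⟩
  clear hw
  have hv : ¬ Reducible k v := (Finset.mem_filter.1 hv).2
  induction h with
  | refl => rfl
  | tail _ h ih =>
    subst ih
    obtain ⟨u, u', r, hr, hu, rfl, huu'⟩ := h
    by_contra hne
    refine hv ⟨u, u', r, hr, hu, fun h => hne (by rw [hu, h]), huu'⟩

lemma IsSystemOfRepresentatives.unlinked {I : ℕ → Finset (Fin n → ℕ)}
    (hI : IsSystemOfRepresentatives k I) : Unlinked k I := by
  refine fun s => ⟨(hI s).1, fun v hv w hw h => ?_⟩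
  obtain ⟨x, -, hx⟩ := (hI s).2 v ((hI s).1 hv)
  rw [hx v ⟨hv, .refl⟩, hx w ⟨hw, h⟩]

variable {I : ℕ → Finset (Fin n → ℕ)}

lemma trade_of_common_part {v w : Fin n → ℕ} {i : Fin n} (hv : v i ≠ 0) (hw : w i ≠ 0)
    (h : value k v = value k w) : Trade k v w := by
  have hv' : v = (v - Pi.single i 1) + Pi.single i 1 :=
    (tsub_add_cancel_of_le (single_le_of_le (Nat.one_le_iff_ne_zero.2 hv))).symm
  have hw' : w = (w - Pi.single i 1) + Pi.single i 1 :=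
    (tsub_add_cancel_of_le (single_le_of_le (Nat.one_le_iff_ne_zero.2 hw))).symm
  refine ⟨_, _, Pi.single i 1, fun h => ?_, hv', hw', ?_⟩
  · simpa using congrFun h i
  · rw [hv', hw', value_add, value_add] at h
    exact Nat.add_right_cancel h

namespace Unlinked

lemma value_eq (hI : Unlinked k I) {s : ℕ} {v : Fin n → ℕ} (hv : v ∈ I s) : value k v = s :=
  value_eq_of_mem_decompositions ((hI s).1 hv)

lemma disjoint (hI : Unlinked k I) {s : ℕ} {v w : Fin n → ℕ} (hv : v ∈ I s) (hw : w ∈ I s)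
    (hne : v ≠ w) (i : Fin n) : v i = 0 ∨ w i = 0 := by
  by_contra! h
  exact hne ((hI s).2 v hv w hw
    (.single (trade_of_common_part h.1 h.2 ((hI.value_eq hv).trans (hI.value_eq hw).symm))))

/-- Distinct members of `I s` have disjoint supports, so `v` is the positive part of `v - w`. Thus a
difference vector remembers the pair `(s, v)` it comes from. -/
lemma diff_injective (hI : Unlinked k I) {s s' : ℕ} {v w v' w' : Fin n → ℕ} (hv : v ∈ I s)
    (hw : w ∈ I s) (hvw : v ≠ w) (hv' : v' ∈ I s') (hw' : w' ∈ I s') (hvw' : v' ≠ w')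
    (h : diff v w = diff v' w') : s = s' ∧ v = v' := by
  have hvv : v = v' := by
    ext i
    have h1 := congrFun h i
    simp only [diff] at h1
    have h2 : v i + w' i = v' i + w i := by
      have : (v i : ℚ) + w' i = v' i + w i := by linarith
      exact_mod_cast this
    have h3 := hI.disjoint hv hw hvw i
    have h4 := hI.disjoint hv' hw' hvw' i
    omega
  exact ⟨by rw [← hI.value_eq hv, hvv, hI.value_eq hv'], hvv⟩

/-- In a large decomposition some part `k_i` occurs more often than any `k_l`. Trading `k_l` copies
of `k_i` for `k_i` copies of `k_l` gives it a part in common with any other decomposition, to which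
it is then linked. The finite support makes `∑ᶠ` in `correctionLength` a genuine sum. -/
lemma phi_eq_zero (hI : Unlinked k I) (hk : StrictMono k) {s : ℕ}
    (hs : (∑ i : Fin n, k i.succ) * (∑ i : Fin n, k i.succ) < s) : phi I s = 0 := by
  set K := ∑ i : Fin n, k i.succ
  by_contra h
  have hcard : 1 < (I s).card := by unfold phi at h; omega
  obtain ⟨v, hv, w, hw, hvw⟩ := Finset.one_lt_card.1 hcard
  have hkK : ∀ i : Fin n, k i.succ ≤ K := fun i =>
    Finset.single_le_sum (f := fun i : Fin n => k i.succ) (fun _ _ => Nat.zero_le _)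
      (Finset.mem_univ i)
  obtain ⟨i, hi⟩ : ∃ i, K < v i := by
    by_contra! hle
    have := hI.value_eq hv
    have h2 : value k v ≤ K * K := by
      rw [value, Finset.mul_sum]
      exact Finset.sum_le_sum fun i _ => Nat.mul_le_mul_right _ (hle i)
    omega
  obtain ⟨l, hl⟩ : ∃ l, w l ≠ 0 := by
    by_contra! hz
    have := hI.value_eq hw
    rw [value, Finset.sum_eq_zero fun i _ => by rw [hz i, zero_mul]] at this
    omega
  have hi' : k l.succ < v i := (hkK l).trans_lt hi
  set r : Fin n → ℕ := v - Pi.single i (k l.succ)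
  have hvr : v = Pi.single i (k l.succ) + r :=
    (add_tsub_cancel_of_le (single_le_of_le hi'.le)).symm
  have hr : r ≠ 0 := fun h0 => by
    have := congrFun h0 i
    simp only [r, Pi.sub_apply, Pi.single_eq_same, Pi.zero_apply] at this
    omega
  have h1 : Trade k v (Pi.single l (k i.succ) + r) :=
    ⟨_, _, r, hr, hvr, rfl, by rw [value_single, value_single, mul_comm]⟩
  have hval : value k (Pi.single l (k i.succ) + r) = value k w := by
    rw [hI.value_eq hw, ← hI.value_eq hv, hvr, value_add, value_add, value_single, value_single,
      mul_comm]
  have hpos := succ_pos_of_strictMono hk i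
  have h2 : Trade k (Pi.single l (k i.succ) + r) w :=
    trade_of_common_part (i := l) (by simp; omega) hl hval
  exact hvw ((hI s).2 v hv w hw (.tail (.single h1) h2))

end Unlinked

end Decompositions

/-! ### Gap counts, the syzygetic defect and the cutoff. -/

section Counting

variable {n : ℕ} {S : AddSubmonoid ℕ} {k : Fin (n + 1) → ℕ} {I : ℕ → Finset (Fin n → ℕ)}
  {ref : ℕ → Fin n → ℕ}

lemma exists_forall_ge_mem (hS : {r : ℕ | r ∉ S}.Finite) : ∃ c, ∀ r, c ≤ r → r ∈ S := by
  obtain ⟨b, hb⟩ := hS.bddAbove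
  exact ⟨b + 1, fun r hr => by_contra fun h => by have := hb h; omega⟩

lemma mem_of_conductor_le (hS : {r : ℕ | r ∉ S}.Finite) {r : ℕ} (hr : conductor S ≤ r) : r ∈ S :=
  Nat.sInf_mem (s := {c : ℕ | ∀ r, c ≤ r → r ∈ S}) (exists_forall_ge_mem hS) r hr

lemma lt_conductor (hS : {r : ℕ | r ∉ S}.Finite) {r : ℕ} (hr : r ∉ S) : r < conductor S :=
  not_le.1 fun h => hr (mem_of_conductor_le hS h)

/-- For a gap `r`, the reflection `x ↦ r - x` sends elements of `S` up to `r` to gaps, so at least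
half of `0, …, r` are gaps. -/
lemma lt_two_mul_genus (hS : {r : ℕ | r ∉ S}.Finite) {r : ℕ} (hr : r ∉ S) :
    r < 2 * genus S := by
  have h1 : (Finset.range (r + 1)).card ≤
      ((Finset.range (r + 1)).filter (· ∉ S)).card +
        ((Finset.range (r + 1)).filter (· ∉ S)).card := by
    rw [← Finset.card_filter_add_card_filter_not (s := Finset.range (r + 1)) (· ∉ S)]
    refine Nat.add_le_add_left (Finset.card_le_card_of_injOn (fun x => r - x) (fun x hx => ?_)
      fun x hx y hy h => ?_) _
    · simp only [Finset.coe_filter, Finset.mem_range, not_not, Set.mem_ofPred_eq] at hx ⊢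
      refine ⟨by omega, fun h => hr ?_⟩
      have := S.add_mem hx.2 h
      rwa [Nat.add_sub_cancel' (by omega)] at this
    · simp only [Finset.coe_filter, Finset.mem_range, Set.mem_ofPred_eq] at hx hy h
      omega
  have h2 : ((Finset.range (r + 1)).filter (· ∉ S)).card ≤ genus S := by
    rw [genus, ← Set.ncard_coe_finset]
    exact Set.ncard_le_ncard (fun x hx => by
      simp only [Finset.coe_filter, Set.mem_ofPred_eq] at hx; exact hx.2) hS
  rw [Finset.card_range] at h1
  omega

/-- The number of gaps of `S` between `s` and `q`. -/
def rhoBelow (S : AddSubmonoid ℕ) (q s : ℕ) : ℕ :=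
  ((Finset.range q).filter fun r => s < r ∧ r ∉ S).card

lemma rho_eq_card (hS : {r : ℕ | r ∉ S}.Finite) {q : ℕ} (hq : conductor S ≤ q) (s : ℕ) :
    rho S s = rhoBelow S q s := by
  rw [rho, rhoBelow, ← Set.ncard_coe_finset]
  congr 1
  ext r
  simp only [Finset.coe_filter, Finset.mem_range, Set.mem_ofPred_eq]
  exact ⟨fun h => ⟨(lt_conductor hS h.2).trans_le hq, h⟩, fun h => h.2⟩

lemma rhoBelow_add_rho (hS : {r : ℕ | r ∉ S}.Finite) {q s : ℕ} (hq : q ∈ S) (hs : s ≤ q) :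
    rho S s = rhoBelow S q s + rho S q := by
  have hfin : ∀ s, {r : ℕ | s < r ∧ r ∉ S}.Finite := fun s => hS.subset fun r hr => hr.2
  rw [rho, rho, rhoBelow, ← Set.ncard_coe_finset, ← Set.ncard_union_eq ?_ (Finset.finite_toSet _)
    (hfin q)]
  · congr 1
    ext r
    simp only [Finset.coe_filter, Finset.mem_range, Set.mem_ofPred_eq, Set.mem_union]
    have : r = q → r ∈ S := fun h => h ▸ hq
    constructor
    · rintro ⟨h1, h2⟩
      rcases lt_trichotomy r q with h | h | h
      exacts [.inl ⟨h, h1, h2⟩, absurd (this h) h2, .inr ⟨h, h2⟩]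
    · rintro (h | h)
      exacts [h.2, ⟨by omega, h.2⟩]
  · rw [Set.disjoint_left]
    intro r hr hr'
    simp only [Finset.coe_filter, Finset.mem_range, Set.mem_ofPred_eq] at hr hr'
    omega

lemma rho_le_of_le (hS : {r : ℕ | r ∉ S}.Finite) {s t : ℕ} (h : s ≤ t) : rho S t ≤ rho S s :=
  Set.ncard_le_ncard (fun _ hr => ⟨h.trans_lt hr.1, hr.2⟩) (hS.subset fun _ hr => hr.2)

lemma rho_le_rhoBelow_add (hS : {r : ℕ | r ∉ S}.Finite) {q : ℕ} (s : ℕ) (hq : q ∈ S) :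
    rho S s ≤ rhoBelow S q s + rho S q := by
  rcases le_total s q with h | h
  · exact (rhoBelow_add_rho hS hq h).le
  · exact (rho_le_of_le hS h).trans (Nat.le_add_left _ _)

/-- The pairs `(s, v)` of a nonzero element `s` of `S` below the conductor and a decomposition
`v ∈ I s` other than the reference decomposition. -/
def syzygies (S : AddSubmonoid ℕ) (I : ℕ → Finset (Fin n → ℕ)) (ref : ℕ → Fin n → ℕ) :
    Finset (Σ _ : ℕ, Fin n → ℕ) :=
  (smallElements S).sigma fun s => (I s).erase (ref s)

/-- The difference attached to a pair `(s, v)`. -/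
def syzygyVector (ref : ℕ → Fin n → ℕ) (σ : Σ _ : ℕ, Fin n → ℕ) : Fin n → ℚ :=
  diff σ.2 (ref σ.1)

/-- The pairs `(s, v)` for which `s + j` is a gap less than `q`. -/
def activeSyzygies (S : AddSubmonoid ℕ) (I : ℕ → Finset (Fin n → ℕ)) (ref : ℕ → Fin n → ℕ)
    (q j : ℕ) : Finset (Σ _ : ℕ, Fin n → ℕ) :=
  (syzygies S I ref).filter fun σ => σ.1 + j ∉ S ∧ σ.1 + j < q

/-- The span of the differences attached to the active pairs `(s, v)`. -/
def activeSpan (S : AddSubmonoid ℕ) (I : ℕ → Finset (Fin n → ℕ)) (ref : ℕ → Fin n → ℕ)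
    (q j : ℕ) : Submodule ℚ (Fin n → ℚ) :=
  Submodule.span ℚ (((activeSyzygies S I ref q j).image (syzygyVector ref) :
    Finset (Fin n → ℚ)) : Set (Fin n → ℚ))

lemma mem_syzygies {σ : Σ _ : ℕ, Fin n → ℕ} :
    σ ∈ syzygies S I ref ↔ (σ.1 < conductor S ∧ σ.1 ∈ S ∧ σ.1 ≠ 0) ∧ σ.2 ≠ ref σ.1 ∧ σ.2 ∈ I σ.1 := by
  simp [syzygies, smallElements, and_assoc]

lemma ref_mem (href : ∀ s, (I s).Nonempty → ref s ∈ I s) {σ : Σ _ : ℕ, Fin n → ℕ}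
    (hσ : σ ∈ syzygies S I ref) : ref σ.1 ∈ I σ.1 :=
  href _ ⟨σ.2, (mem_syzygies.1 hσ).2.2⟩

lemma syzygyVector_injOn (hI : Unlinked k I) (href : ∀ s, (I s).Nonempty → ref s ∈ I s) :
    Set.InjOn (syzygyVector ref) (syzygies S I ref : Set (Σ _ : ℕ, Fin n → ℕ)) := by
  rintro ⟨s, v⟩ hσ ⟨s', v'⟩ hσ' h
  have h1 := mem_syzygies.1 hσ
  have h2 := mem_syzygies.1 hσ'
  obtain ⟨h3, h4⟩ := hI.diff_injective h1.2.2 (ref_mem href hσ) h1.2.1 h2.2.2 (ref_mem href hσ')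
    h2.2.1 h
  simp only at h3 h4
  rw [h3, h4]

lemma syzygyVector_mem_columnVectors {σ : Σ _ : ℕ, Fin n → ℕ} (hσ : σ ∈ syzygies S I ref) :
    syzygyVector ref σ ∈ columnVectors I ref σ.1 :=
  Finset.mem_image_of_mem _ (Finset.mem_erase.2 (mem_syzygies.1 hσ).2)

lemma activeVectors_subset_groundSet (q j : ℕ) :
    (activeSyzygies S I ref q j).image (syzygyVector ref) ⊆ groundSet S I ref := by
  intro e he
  obtain ⟨σ, hσ, rfl⟩ := Finset.mem_image.1 he
  have hσ' := (Finset.mem_filter.1 hσ).1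
  exact Finset.mem_biUnion.2 ⟨σ.1, (Finset.mem_sigma.1 hσ').1, syzygyVector_mem_columnVectors hσ'⟩

/-- A circuit consisting of active differences has an active top element. -/
lemma topElement_add_notMem (hI : Unlinked k I) (href : ∀ s, (I s).Nonempty → ref s ∈ I s)
    {q j : ℕ} {C : Finset (Fin n → ℚ)}
    (hCne : C.Nonempty) (hC : C ⊆ (activeSyzygies S I ref q j).image (syzygyVector ref)) :
    topElement S I ref C + j ∉ S ∧ topElement S I ref C + j < q := by
  set T := (smallElements S).filter fun s => (columnVectors I ref s ∩ C).Nonempty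
  have hT : T.Nonempty := by
    obtain ⟨e, he⟩ := hCne
    obtain ⟨σ, hσ, rfl⟩ := Finset.mem_image.1 (hC he)
    have hσ' := (Finset.mem_filter.1 hσ).1
    exact ⟨σ.1, Finset.mem_filter.2 ⟨(Finset.mem_sigma.1 hσ').1,
      _, Finset.mem_inter.2 ⟨syzygyVector_mem_columnVectors hσ', he⟩⟩⟩
  obtain ⟨s, hs, hsup⟩ := Finset.exists_mem_eq_sup T hT id
  have htop : topElement S I ref C = s := hsup
  rw [htop]
  obtain ⟨hs1, e, he⟩ := Finset.mem_filter.1 hs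
  obtain ⟨he1, he2⟩ := Finset.mem_inter.1 he
  obtain ⟨σ, hσ, rfl⟩ := Finset.mem_image.1 (hC he2)
  obtain ⟨v, hv, hve⟩ := Finset.mem_image.1 he1
  have hτ : (⟨s, v⟩ : Σ _ : ℕ, Fin n → ℕ) ∈ syzygies S I ref := Finset.mem_sigma.2 ⟨hs1, hv⟩
  -- The pair realizing the top element and the active pair have the same vector, so they coincide
  -- and the top element inherits activity.
  have := syzygyVector_injOn hI href hτ (Finset.mem_filter.1 hσ).1 hve
  have h := (Finset.mem_filter.1 hσ).2
  rw [← this] at h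
  exact h

/-- The substitution `r = s + j` converts a count of gaps into a count of weights, so sums over `s`
can be exchanged for sums over `j`. -/
lemma card_active_weights (S : AddSubmonoid ℕ) (q s : ℕ) :
    ((Finset.Icc 1 q).filter fun j => s + j ∉ S ∧ s + j < q).card = rhoBelow S q s := by
  refine Finset.card_bij (fun j _ => s + j) (fun j hj => ?_) (fun a _ b _ h => by omega)
    fun r hr => ?_
  · simp only [Finset.mem_filter, Finset.mem_Icc, Finset.mem_range] at hj ⊢
    exact ⟨hj.2.2, by omega, hj.2.1⟩
  · simp only [Finset.mem_filter, Finset.mem_range] at hr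
    refine ⟨r - s, ?_, by omega⟩
    simp only [Finset.mem_filter, Finset.mem_Icc]
    rw [Nat.add_sub_cancel' hr.2.1.le]
    exact ⟨by omega, hr.2.2, hr.1⟩

/-- Weight by weight, the nullity of the active vectors is at most the number of their circuits. A
circuit `C` can occur only in weights `j` for which `topElement + j` is a gap below `q`, hence at
most `ρ(topElement)` times. -/
theorem sum_rhoBelow_le (hS : {r : ℕ | r ∉ S}.Finite) (hI : Unlinked k I)
    (href : ∀ s, (I s).Nonempty → ref s ∈ I s) {q : ℕ} (hq : q ≤ conductor S) :
    ∑ σ ∈ syzygies S I ref, rhoBelow S q σ.1 ≤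
      ∑ j ∈ Finset.Icc 1 q, Module.finrank ℚ (activeSpan S I ref q j) +
        syzygeticDefect S I ref := by
  set A := fun j => (activeSyzygies S I ref q j).image (syzygyVector ref)
  have hcirc : ∀ j, (A j).card ≤ Module.finrank ℚ (activeSpan S I ref q j) +
      ((circuits S I ref).filter fun C =>
        topElement S I ref C + j ∉ S ∧ topElement S I ref C + j < q).card := by
    intro j
    refine (card_le_finrank_add_circuits (A j)).trans (Nat.add_le_add_left
      (Finset.card_le_card fun C hC => ?_) _)
    obtain ⟨hCA, hC⟩ := Finset.mem_filter.1 hC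
    have hCA := Finset.mem_powerset.1 hCA
    refine Finset.mem_filter.2 ⟨Finset.mem_filter.2 ⟨Finset.mem_powerset.2
      (hCA.trans (activeVectors_subset_groundSet q j)), hC⟩, ?_⟩
    refine topElement_add_notMem hI href ?_ hCA
    rw [Finset.nonempty_iff_ne_empty]
    rintro rfl
    exact hC.1 (by simp)
  calc ∑ σ ∈ syzygies S I ref, rhoBelow S q σ.1
      = ∑ j ∈ Finset.Icc 1 q, (activeSyzygies S I ref q j).card := by
        simp_rw [← card_active_weights, activeSyzygies, Finset.card_filter]
        exact Finset.sum_comm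
    _ = ∑ j ∈ Finset.Icc 1 q, (A j).card := Finset.sum_congr rfl fun j _ =>
        (Finset.card_image_of_injOn ((syzygyVector_injOn hI href).mono
          (Finset.coe_subset.2 (Finset.filter_subset _ _)))).symm
    _ ≤ _ := Finset.sum_le_sum fun j _ => hcirc j
    _ = ∑ j ∈ Finset.Icc 1 q, Module.finrank ℚ (activeSpan S I ref q j) +
        ∑ C ∈ circuits S I ref, rhoBelow S q (topElement S I ref C) := by
        rw [Finset.sum_add_distrib]
        congr 1
        simp_rw [← card_active_weights, Finset.card_filter]
        exact Finset.sum_comm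
    _ ≤ _ := by
        refine Nat.add_le_add_left (Finset.sum_le_sum fun C _ => ?_) _
        rw [rho_eq_card hS le_rfl]
        exact Finset.card_le_card (Finset.filter_subset_filter _ (Finset.range_subset_range.2 hq))

lemma sum_phi_mul_rho_le (hS : {r : ℕ | r ∉ S}.Finite)
    (href : ∀ s, (I s).Nonempty → ref s ∈ I s) :
    ∑ s ∈ (Finset.Icc 1 (2 * genus S)).filter (· ∈ S), phi I s * rho S s ≤
      ∑ σ ∈ syzygies S I ref, rho S σ.1 := by
  have hphi : ∀ s, phi I s = ((I s).erase (ref s)).card := by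
    intro s
    rcases (I s).eq_empty_or_nonempty with h | h
    · simp [phi, h]
    · rw [phi, Finset.card_erase_of_mem (href s h)]
  have : ∑ σ ∈ syzygies S I ref, rho S σ.1 = ∑ s ∈ smallElements S, phi I s * rho S s := by
    rw [syzygies, Finset.sum_sigma]
    simp [hphi]
  rw [this]
  -- Terms with `ρ(s) = 0` are dropped; a nonzero `ρ(s)` puts `s` below a gap, hence below the
  -- conductor.
  rw [← Finset.sum_filter_ne_zero]
  refine Finset.sum_le_sum_of_subset fun s hs => ?_
  simp only [Finset.mem_filter, Finset.mem_Icc] at hs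
  have h0 : rho S s ≠ 0 := right_ne_zero_of_mul hs.2
  obtain ⟨r, hr⟩ := Set.nonempty_of_ncard_ne_zero h0
  simp only [smallElements, Finset.mem_filter, Finset.mem_range]
  exact ⟨hr.1.trans (lt_conductor hS hr.2), hs.1.2, by omega⟩

lemma card_syzygies_le (hI : Unlinked k I) (hk : StrictMono k)
    (href : ∀ s, (I s).Nonempty → ref s ∈ I s) :
    (syzygies S I ref).card ≤ ∑ᶠ s ∈ S, phi I s := by
  have hphi : ∀ s, ((I s).erase (ref s)).card = phi I s := by
    intro s
    rcases (I s).eq_empty_or_nonempty with h | h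
    · simp [phi, h]
    · rw [phi, Finset.card_erase_of_mem (href s h)]
  set b := (∑ i : Fin n, k i.succ) * (∑ i : Fin n, k i.succ)
  have hfin : ∑ᶠ s ∈ S, phi I s =
      ∑ s ∈ (Finset.range (b + 1 + conductor S)).filter (· ∈ S), phi I s := by
    refine finsum_mem_eq_sum_of_inter_support_eq (s := (S : Set ℕ)) (phi I) ?_
    ext s
    simp only [Set.mem_inter_iff, SetLike.mem_coe, Function.mem_support, Finset.coe_filter,
      Finset.mem_range, Set.mem_ofPred_eq]
    refine ⟨fun h => ⟨⟨?_, h.1⟩, h.2⟩, fun h => ⟨h.1.2, h.2⟩⟩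
    by_contra hs
    exact h.2 (hI.phi_eq_zero hk (by omega))
  rw [hfin, syzygies, Finset.card_sigma]
  simp_rw [hphi]
  refine Finset.sum_le_sum_of_subset fun s hs => ?_
  simp only [smallElements, Finset.mem_filter, Finset.mem_range] at hs ⊢
  exact ⟨by omega, hs.2.1⟩

/-- Only the conditions at the gaps below a cutoff `q` are needed: beyond `q`, the corrections
for the missing generators outweigh them. -/
theorem exists_cutoff (hS : {r : ℕ | r ∉ S}.Finite) (hI : Unlinked k I) (hk : StrictMono k)
    (href : ∀ s, (I s).Nonempty → ref s ∈ I s) :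
    ∃ q ≤ conductor S,
      ∑ s ∈ (Finset.Icc 1 (2 * genus S)).filter (· ∈ S), phi I s * rho S s +
          ∑ s ∈ (missingGenerators S k).filter (· < q), rhoBelow S q s ≤
        ∑ σ ∈ syzygies S I ref, rhoBelow S q σ.1 + generatorCorrection S k I := by
  have h1 := sum_phi_mul_rho_le (I := I) hS href
  have h2 := card_syzygies_le (S := S) hI hk href
  set l := (missingGenerators S k).sort (· ≤ ·) with hl
  have hlen : l.length = (missingGenerators S k).card := Finset.length_sort _
  have hnd : l.Nodup := Finset.sort_nodup _ _
  have hgc : ∀ m, ((l.take m).map (rho S)).sum = ∑ s ∈ (l.take m).toFinset, rho S s := fun m =>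
    (List.sum_toFinset _ (hnd.sublist (List.take_sublist _ _))).symm
  -- If the correction covers every missing generator, no truncation is needed and the cutoff is the
  -- conductor.
  by_cases hm : (missingGenerators S k).card ≤ ∑ᶠ s ∈ S, phi I s
  · refine ⟨conductor S, le_rfl, ?_⟩
    have hgc' : generatorCorrection S k I = ∑ s ∈ missingGenerators S k, rho S s := by
      rw [generatorCorrection, correctionLength, min_eq_left hm, ← hl, hgc, ← hlen,
        List.take_length, hl, Finset.sort_toFinset]
    simp_rw [← rho_eq_card hS le_rfl]
    rw [hgc']
    exact add_le_add h1 (Finset.sum_le_sum_of_subset (Finset.filter_subset _ _))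
  · push Not at hm
    set m := ∑ᶠ s ∈ S, phi I s
    have hml : m < l.length := hlen ▸ hm
    have hq := (Finset.mem_sort (· ≤ ·)).1 (List.getElem_mem hml)
    simp only [missingGenerators, Finset.mem_filter, Finset.mem_range] at hq
    -- With zero-based indexing, `l[m]` is the first missing generator outside the correction, so
    -- exactly `m` lie below the cutoff.
    refine ⟨l[m], hq.1.le, ?_⟩
    have hmono : StrictMono fun i : Fin l.length => l[i] := 
      (missingGenerators S k).sortedLT_sort.strictMono_get
    have htake : (l.take m).toFinset = (missingGenerators S k).filter (· < l[m]) := by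
      ext s
      rw [List.mem_toFinset, Finset.mem_filter, List.mem_take_iff_getElem,
        ← Finset.mem_sort (· ≤ ·), ← hl, List.mem_iff_getElem]
      constructor
      · rintro ⟨i, hi, rfl⟩
        exact ⟨⟨i, by omega, rfl⟩, @hmono ⟨i, by omega⟩ ⟨m, hml⟩ (by simp; omega)⟩
      · rintro ⟨⟨i, hi, rfl⟩, h⟩
        have : i < m := (hmono.lt_iff_lt (a := ⟨i, hi⟩) (b := ⟨m, hml⟩)).1 h
        exact ⟨i, by omega, rfl⟩
    have hcard : ((missingGenerators S k).filter (· < l[m])).card = m := by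
      rw [← htake, List.toFinset_card_of_nodup (hnd.sublist (List.take_sublist _ _)),
        List.length_take, min_eq_left hml.le]
    have hgc' : generatorCorrection S k I =
        ∑ s ∈ (missingGenerators S k).filter (· < l[m]), rhoBelow S l[m] s + m * rho S l[m] := by
      rw [generatorCorrection, correctionLength, min_eq_right hm.le, ← hl, hgc, htake]
      have : m * rho S l[m] = ∑ s ∈ (missingGenerators S k).filter (· < l[m]), rho S l[m] := by
        rw [Finset.sum_const, hcard, smul_eq_mul]
      rw [this, ← Finset.sum_add_distrib]
      exact Finset.sum_congr rfl fun s hs =>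
        rhoBelow_add_rho hS hq.2.1.1 (Finset.mem_filter.1 hs).2.le
    -- Each syzygy loses at most `ρ(q)`, and there are at most `m` of them; the `m` corrections each
    -- contain a surplus `ρ(q)`.
    have h3 : ∑ σ ∈ syzygies S I ref, rho S σ.1 ≤
        ∑ σ ∈ syzygies S I ref, rhoBelow S l[m] σ.1 + m * rho S l[m] := by
      refine (Finset.sum_le_sum fun σ _ => rho_le_rhoBelow_add hS σ.1 hq.2.1.1).trans ?_
      rw [Finset.sum_add_distrib, Finset.sum_const, smul_eq_mul]
      gcongr
    omega

end Counting

/-! ### Value semigroup and vanishing orders through products of sections. -/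

section Values

variable {n d : ℕ}

lemma map_evalForm {A B : Type} [CommRing A] [CommRing B] [Algebra ℂ A] [Algebra ℂ B]
    (f : A →ₐ[ℂ] B) (a : Fin (n + 1) × Fin (d + 1) → ℂ) (i : Fin (n + 1)) (u v : A) :
    f (evalForm a i u v) = evalForm a i (f u) (f v) := by
  simp [evalForm]

lemma evalForm_mul {A : Type} [CommRing A] [Algebra ℂ A]
    (a : Fin (n + 1) × Fin (d + 1) → ℂ) (i : Fin (n + 1)) (c u v : A) :
    evalForm a i (c * u) (c * v) = c ^ d * evalForm a i u v := by
  simp only [evalForm, Finset.mul_sum]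
  refine Finset.sum_congr rfl fun j _ => ?_
  have : c ^ d = c ^ (j : ℕ) * c ^ (d - (j : ℕ)) := by
    rw [← pow_add, Nat.add_sub_cancel' (Nat.lt_succ_iff.1 j.2)]
  rw [this, mul_pow, mul_pow]
  ring

/-- The span of the local sections. -/
def sectionSpace (a : Fin (n + 1) × Fin (d + 1) → ℂ) (P Q : Fin 2 → ℂ) : Submodule ℂ ℂ⟦X⟧ :=
  Submodule.span ℂ (Set.range (localSection a P Q))

lemma constantCoeff_localSection (a : Fin (n + 1) × Fin (d + 1) → ℂ) (P Q : Fin 2 → ℂ)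
    (i : Fin (n + 1)) :
    PowerSeries.constantCoeff (localSection a P Q i) = evalForm a i (P 0) (P 1) := by
  simp [localSection, evalForm]

section Chart

variable {a : Fin (n + 1) × Fin (d + 1) → ℂ} {P Q : Fin 2 → ℂ} {j : Fin (n + 1)}

lemma localSection_mul_inv (hj : evalForm a j (P 0) (P 1) ≠ 0) :
    localSection a P Q j * (localSection a P Q j)⁻¹ = 1 :=
  PowerSeries.mul_inv_cancel _ (by rwa [constantCoeff_localSection])

lemma order_localSection_pow (hj : evalForm a j (P 0) (P 1) ≠ 0) (e : ℕ) :
    (localSection a P Q j ^ e).order = 0 := by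
  rw [PowerSeries.order_pow, PowerSeries.order_zero_of_unit
    (IsUnit.of_mul_eq_one _ (localSection_mul_inv hj)), smul_zero]

lemma hasSubst_localCoordinate : MvPowerSeries.HasSubst (localCoordinate a P Q j) := by
  refine MvPowerSeries.hasSubst_of_constantCoeff_zero fun i => ?_
  change PowerSeries.constantCoeff (localCoordinate a P Q j i) = 0
  simp [localCoordinate]

lemma localSection_eq_mul (hj : evalForm a j (P 0) (P 1) ≠ 0) (i : Fin (n + 1)) :
    ∃ c : ℂ, localSection a P Q i =
      localSection a P Q j * (localCoordinate a P Q j i + PowerSeries.C c) := by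
  refine ⟨PowerSeries.constantCoeff (localSection a P Q i * (localSection a P Q j)⁻¹), ?_⟩
  rw [localCoordinate, sub_add_cancel, mul_left_comm, localSection_mul_inv hj, mul_one]

/-- Dehomogenization: each section is the unit `F_j` times an affine coordinate plus a constant. -/
lemma exists_subst_of_mem_pow (hj : evalForm a j (P 0) (P 1) ≠ 0) {e : ℕ} {h : ℂ⟦X⟧}
    (hh : h ∈ sectionSpace a P Q ^ e) :
    ∃ G : MvPowerSeries (Fin (n + 1)) ℂ,
      h = localSection a P Q j ^ e * (MvPowerSeries.subst (localCoordinate a P Q j) G : ℂ⟦X⟧) := by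
  have hs := hasSubst_localCoordinate (a := a) (P := P) (Q := Q) (j := j)
  have hC : ∀ c : ℂ, (MvPowerSeries.substAlgHom (R := ℂ) hs (MvPowerSeries.C c) : ℂ⟦X⟧) =
      PowerSeries.C c := fun c => AlgHom.commutes (MvPowerSeries.substAlgHom hs) c
  simp_rw [← MvPowerSeries.coe_substAlgHom hs]
  induction hh using Submodule.pow_induction_on_left' with
  | algebraMap r =>
    exact ⟨MvPowerSeries.C r, by rw [hC, pow_zero, one_mul]; rfl⟩
  | add x y i hx hy ihx ihy =>
    obtain ⟨G, hG⟩ := ihx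
    obtain ⟨H, hH⟩ := ihy
    exact ⟨G + H, by rw [hG, hH, map_add]; exact (mul_add _ _ _).symm⟩
  | mem_mul m hm i x hx ih =>
    obtain ⟨G, hG⟩ := ih
    have : ∃ H : MvPowerSeries (Fin (n + 1)) ℂ,
        m = localSection a P Q j * (MvPowerSeries.substAlgHom hs H : ℂ⟦X⟧) := by
      induction hm using Submodule.span_induction with
      | mem x hx =>
        obtain ⟨i, rfl⟩ := hx
        obtain ⟨c, hc⟩ := localSection_eq_mul (Q := Q) hj i
        refine ⟨MvPowerSeries.X i + MvPowerSeries.C c, hc.trans ?_⟩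
        rw [map_add, MvPowerSeries.substAlgHom_X, hC]
      | zero => exact ⟨0, by rw [map_zero]; exact (mul_zero _).symm⟩
      | add x y _ _ ihx ihy =>
        obtain ⟨G, hG⟩ := ihx
        obtain ⟨H, hH⟩ := ihy
        exact ⟨G + H, by rw [hG, hH, map_add]; exact (mul_add _ _ _).symm⟩
      | smul c x _ ih =>
        obtain ⟨G, hG⟩ := ih
        exact ⟨c • G, by rw [hG, map_smul]; exact (mul_smul_comm _ _ _).symm⟩
    obtain ⟨H, hH⟩ := this
    refine ⟨H * G, ?_⟩
    rw [hH, hG, map_mul, pow_succ']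
    exact mul_mul_mul_comm _ _ _ _

lemma mul_aeval_mem_pow (hj : evalForm a j (P 0) (P 1) ≠ 0) {e : ℕ}
    (p : MvPolynomial (Fin (n + 1)) ℂ) (hp : p.totalDegree ≤ e) :
    localSection a P Q j ^ e * MvPolynomial.aeval (localCoordinate a P Q j) p ∈
      sectionSpace a P Q ^ e := by
  set V := sectionSpace a P Q
  set F := localSection a P Q
  have hF : ∀ i, F i ∈ V := fun i => Submodule.subset_span ⟨i, rfl⟩
  have hx : ∀ i, F j * localCoordinate a P Q j i ∈ V := by
    intro i
    obtain ⟨c, hc⟩ := localSection_eq_mul (Q := Q) hj i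
    have : F j * localCoordinate a P Q j i = F i - c • F j := by
      rw [show F i = _ from hc, PowerSeries.smul_eq_C_mul]; ring
    rw [this]
    exact V.sub_mem (hF i) (V.smul_mem _ (hF j))
  have hmon : ∀ m : Fin (n + 1) →₀ ℕ,
      F j ^ m.degree * (m.prod fun i l => localCoordinate a P Q j i ^ l) ∈ V ^ m.degree := by
    intro m
    induction m using Finsupp.induction_linear with
    | zero => simpa using Submodule.one_le.1 (le_refl (1 : Submodule ℂ ℂ⟦X⟧))
    | add m m' hm hm' =>
      rw [map_add, pow_add, pow_add, Finsupp.prod_add_index' (fun _ => pow_zero _)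
        (fun _ _ _ => pow_add _ _ _), mul_mul_mul_comm]
      exact Submodule.mul_mem_mul hm hm'
    | single i l =>
      rw [Finsupp.prod_single_index (h := fun i l => localCoordinate a P Q j i ^ l) (pow_zero _),
        Finsupp.degree_single, ← mul_pow]
      exact Submodule.pow_mem_pow _ (hx i) _
  rw [MvPolynomial.aeval_def, MvPolynomial.eval₂_eq', Finset.mul_sum]
  refine Submodule.sum_mem _ fun m hm => ?_
  have hme : m.degree ≤ e := (MvPolynomial.le_totalDegree hm).trans hp
  have h1 := Submodule.mul_mem_mul (Submodule.pow_mem_pow V (hF j) (e - m.degree)) (hmon m)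
  rw [← pow_add, Nat.sub_add_cancel hme, ← mul_assoc, ← pow_add, Nat.sub_add_cancel hme] at h1
  have h2 := Submodule.smul_mem _ (p.coeff m) h1
  rw [Finsupp.prod_fintype _ _ fun _ => pow_zero _] at h2
  convert h2 using 1
  rw [Algebra.smul_def, mul_left_comm]

/-- The centred coordinates have positive order, so discarding terms of total degree above `s` does
not change coefficients up to `s`. The remaining polynomial is homogenized by `F_j ^ s`, a unit. -/
lemma exists_order_subst_eq (hj : evalForm a j (P 0) (P 1) ≠ 0) {s : ℕ}
    {G : MvPowerSeries (Fin (n + 1)) ℂ}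
    (hG : PowerSeries.order (MvPowerSeries.subst (localCoordinate a P Q j) G : ℂ⟦X⟧) = (s : ℕ∞)) :
    ∃ h ∈ sectionSpace a P Q ^ s, h.order = (s : ℕ∞) := by
  have hs := hasSubst_localCoordinate (a := a) (P := P) (Q := Q) (j := j)
  set p := MvPowerSeries.truncTotal (s + 1) G
  refine ⟨_, mul_aeval_mem_pow hj p (Nat.lt_succ_iff.1
    (MvPowerSeries.totalDegree_truncTotal_lt _ (Nat.succ_ne_zero s))), ?_⟩
  rw [PowerSeries.order_mul, order_localSection_pow hj, zero_add]
  have h1 : (MvPowerSeries.subst (localCoordinate a P Q j) (p : MvPowerSeries (Fin (n + 1)) ℂ) :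
      ℂ⟦X⟧) = MvPolynomial.aeval (localCoordinate a P Q j) p := MvPowerSeries.subst_coe p
  have h2 : ((s + 1 : ℕ) : ℕ∞) ≤ (G - (p : MvPowerSeries (Fin (n + 1)) ℂ)).order := by
    refine MvPowerSeries.nat_le_order fun m hm => ?_
    rw [map_sub, MvPolynomial.coeff_coe, MvPowerSeries.coeff_truncTotal _ hm, sub_self]
  have h3 : (1 : ℕ∞) ≤ ⨅ i, MvPowerSeries.order (localCoordinate a P Q j i) := by
    refine le_iInf fun i => ?_
    rw [MvPowerSeries.one_le_order_iff_constCoeff_eq_zero]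
    change PowerSeries.constantCoeff (localCoordinate a P Q j i) = 0
    simp [localCoordinate]
  have h4 := MvPowerSeries.le_order_subst hs (G - (p : MvPowerSeries (Fin (n + 1)) ℂ))
  have h5 : ((s + 1 : ℕ) : ℕ∞) ≤ PowerSeries.order (MvPowerSeries.subst (localCoordinate a P Q j)
      (G - (p : MvPowerSeries (Fin (n + 1)) ℂ)) : ℂ⟦X⟧) := by
    rw [PowerSeries.order_eq_order]
    refine le_trans ?_ h4
    calc ((s + 1 : ℕ) : ℕ∞) = 1 * ((s + 1 : ℕ) : ℕ∞) := (one_mul _).symm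
      _ ≤ _ := mul_le_mul' h3 h2
  rw [MvPowerSeries.subst_sub hs, h1] at h5
  set A : ℂ⟦X⟧ := MvPowerSeries.subst (localCoordinate a P Q j) G
  set B : ℂ⟦X⟧ := MvPolynomial.aeval (localCoordinate a P Q j) p
  have h6 : ∀ m < s + 1, PowerSeries.coeff m B = PowerSeries.coeff m A := by
    intro m hm
    have : PowerSeries.coeff m (A - B) = 0 :=
      PowerSeries.coeff_of_lt_order _ (lt_of_lt_of_le (by exact_mod_cast hm) h5)
    rw [map_sub, sub_eq_zero] at this
    exact this.symm
  rw [PowerSeries.order_eq_nat] at hG ⊢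
  exact ⟨by rw [h6 s (by omega)]; exact hG.1, fun i hi => by rw [h6 i (by omega)]; exact hG.2 i hi⟩

end Chart

lemma order_aeval_eq {τ : ℂ⟦X⟧} (hτ : τ.order = 1) (ψ : Polynomial ℂ) :
    (Polynomial.aeval τ ψ).order = (ψ : ℂ⟦X⟧).order := by
  by_cases hψ : ψ = 0
  · simp [hψ]
  obtain ⟨χ, hχ, hχ0⟩ := Polynomial.exists_eq_pow_rootMultiplicity_mul_and_not_dvd ψ hψ 0
  rw [map_zero, sub_zero] at hχ hχ0
  rw [Polynomial.X_dvd_iff] at hχ0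
  have h1 : (χ : ℂ⟦X⟧).order = 0 := by
    rw [PowerSeries.order_eq_nat (n := 0) |>.2]
    · rfl
    · simpa using hχ0
  have hτ0 : PowerSeries.constantCoeff τ = 0 := by
    rw [← PowerSeries.one_le_order_iff_constCoeff_eq_zero, hτ]
  have h2 : (Polynomial.aeval τ χ).order = 0 := by
    refine (PowerSeries.order_eq_nat (n := 0)).2 ⟨?_, by simp⟩
    rw [PowerSeries.coeff_zero_eq_constantCoeff_apply, Polynomial.aeval_def, Polynomial.hom_eval₂,
      hτ0]
    have : (PowerSeries.constantCoeff (R := ℂ)).comp (algebraMap ℂ ℂ⟦X⟧) = RingHom.id ℂ := by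
      ext c; exact PowerSeries.constantCoeff_C c
    rw [this, Polynomial.eval₂_id, ← Polynomial.coeff_zero_eq_eval_zero]
    exact hχ0
  rw [hχ, map_mul, map_pow, Polynomial.aeval_X, Polynomial.coe_mul, Polynomial.coe_pow,
    Polynomial.coe_X, PowerSeries.order_mul, PowerSeries.order_mul, h1, h2, PowerSeries.order_pow,
    PowerSeries.order_pow, hτ, PowerSeries.order_X]

/-- The vanishing orders of products of sections do not depend on the local parameter. -/
lemma exists_mem_pow_order_eq (a : Fin (n + 1) × Fin (d + 1) → ℂ) {P Q Q' : Fin 2 → ℂ}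
    (hQ : Indep P Q) (hQ' : Indep P Q') {e : ℕ} {h : ℂ⟦X⟧} (hh : h ∈ sectionSpace a P Q' ^ e) :
    ∃ h' ∈ sectionSpace a P Q ^ e, h'.order = h.order := by
  set D := P 0 * Q 1 - P 1 * Q 0 with hD
  have hD0 : D ≠ 0 := hQ
  -- Cramer's rule for `Q' = α P + β Q`. Then `P + t Q' = u (P + τ Q)` with `u = 1 + α t` a unit and
  -- `τ = β t / u` another local parameter.
  set α := (Q' 0 * Q 1 - Q' 1 * Q 0) / D with hα
  set β := (P 0 * Q' 1 - P 1 * Q' 0) / D with hβ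
  have hβ0 : β ≠ 0 := div_ne_zero hQ' hD0
  have hQ'0 : Q' 0 = α * P 0 + β * Q 0 := by rw [hα, hβ]; field_simp; rw [hD]; ring
  have hQ'1 : Q' 1 = α * P 1 + β * Q 1 := by rw [hα, hβ]; field_simp; rw [hD]; ring
  set u : ℂ⟦X⟧ := 1 + PowerSeries.C α * PowerSeries.X with hu
  have hu0 : PowerSeries.constantCoeff u ≠ 0 := by simp [hu]
  have huu : u * u⁻¹ = 1 := PowerSeries.mul_inv_cancel _ hu0
  have huunit : IsUnit u := IsUnit.of_mul_eq_one _ huu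
  set τ : ℂ⟦X⟧ := PowerSeries.C β * PowerSeries.X * u⁻¹ with hτ
  have hτ1 : τ.order = 1 := by
    rw [hτ, PowerSeries.order_mul, PowerSeries.order_mul, PowerSeries.order_X,
      PowerSeries.order_zero_of_unit ((PowerSeries.isUnit_iff_constantCoeff).2
        (by simpa using hβ0) : IsUnit (PowerSeries.C β)),
      PowerSeries.order_zero_of_unit (IsUnit.of_mul_eq_one _ ((mul_comm u⁻¹ u).trans huu))]
    simp
  -- The local sections are polynomials, so the change of parameter is a polynomial evaluation at
  -- `τ` and needs no composition of power series.
  let φ : Fin (n + 1) → Polynomial ℂ := fun i =>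
    evalForm a i (Polynomial.C (P 0) + Polynomial.C (Q 0) * Polynomial.X)
      (Polynomial.C (P 1) + Polynomial.C (Q 1) * Polynomial.X)
  have hφ : ∀ i, (φ i : ℂ⟦X⟧) = localSection a P Q i := by
    intro i
    have := map_evalForm (Polynomial.coeToPowerSeries.algHom (R := ℂ) ℂ) a i
      (Polynomial.C (P 0) + Polynomial.C (Q 0) * Polynomial.X)
      (Polynomial.C (P 1) + Polynomial.C (Q 1) * Polynomial.X)
    simpa [localSection, φ] using this
  have hφ' : ∀ i, localSection a P Q' i = u ^ d * Polynomial.aeval τ (φ i) := by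
    intro i
    have h1 : ∀ l, PowerSeries.C (P l) + PowerSeries.C (α * P l + β * Q l) * PowerSeries.X =
        u * (PowerSeries.C (P l) + PowerSeries.C (Q l) * τ) := by
      intro l
      rw [hτ]
      calc _ = u * PowerSeries.C (P l) +
            (u * u⁻¹) * (PowerSeries.C (Q l) * (PowerSeries.C β * PowerSeries.X)) := by
            rw [huu, hu]; simp only [map_add, map_mul]; ring
        _ = _ := by ring
    rw [map_evalForm, ← evalForm_mul, localSection, hQ'0, hQ'1, h1, h1]
    simp only [map_add, map_mul, Polynomial.aeval_C, Polynomial.aeval_X]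
    rfl
  obtain ⟨ψ, hψ, rfl⟩ : ∃ ψ : Polynomial ℂ, (ψ : ℂ⟦X⟧) ∈ sectionSpace a P Q ^ e ∧
      h = (u ^ d) ^ e * Polynomial.aeval τ ψ := by
    induction hh using Submodule.pow_induction_on_left' with
    | algebraMap r =>
      refine ⟨Polynomial.C r, ?_, by rw [Polynomial.aeval_C, pow_zero, one_mul]⟩
      rw [Polynomial.coe_C, pow_zero]
      exact Submodule.algebraMap_mem r
    | add x y i hx hy ihx ihy =>
      obtain ⟨ψ, hψ, rfl⟩ := ihx
      obtain ⟨χ, hχ, rfl⟩ := ihy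
      refine ⟨ψ + χ, ?_, by rw [map_add, mul_add]⟩
      rw [Polynomial.coe_add]
      exact Submodule.add_mem _ hψ hχ
    | mem_mul m hm i x hx ih =>
      obtain ⟨ψ, hψ, rfl⟩ := ih
      obtain ⟨χ, hχ, rfl⟩ : ∃ χ : Polynomial ℂ, (χ : ℂ⟦X⟧) ∈ sectionSpace a P Q ∧
          m = u ^ d * Polynomial.aeval τ χ := by
        induction hm using Submodule.span_induction with
        | mem x hx =>
          obtain ⟨i, rfl⟩ := hx
          exact ⟨φ i, by rw [hφ]; exact Submodule.subset_span ⟨i, rfl⟩, hφ' i⟩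
        | zero => exact ⟨0, by simp, by simp⟩
        | add x y _ _ ihx ihy =>
          obtain ⟨ψ, hψ, rfl⟩ := ihx
          obtain ⟨χ, hχ, rfl⟩ := ihy
          refine ⟨ψ + χ, ?_, by rw [map_add, mul_add]⟩
          rw [Polynomial.coe_add]
          exact Submodule.add_mem _ hψ hχ
        | smul c x _ ih =>
          obtain ⟨ψ, hψ, rfl⟩ := ih
          refine ⟨c • ψ, ?_, by rw [map_smul, mul_smul_comm]⟩
          rw [Polynomial.coe_smul]
          exact Submodule.smul_mem _ _ hψ
      refine ⟨χ * ψ, ?_, by rw [map_mul, pow_succ']; ring⟩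
      rw [Polynomial.coe_mul, pow_succ']
      exact Submodule.mul_mem_mul hχ hψ
  refine ⟨ψ, hψ, ?_⟩
  rw [PowerSeries.order_mul, PowerSeries.order_zero_of_unit ((huunit.pow d).pow e), zero_add,
    order_aeval_eq hτ1]

/-- This replaces formal power series in the coordinates by the spaces `V ^ e` of products of
sections, in one fixed local parameter. -/
theorem mem_valueSet_iff {a : Fin (n + 1) × Fin (d + 1) → ℂ} {P Q : Fin 2 → ℂ} (hQ : Indep P Q)
    (ha : ∃ j, evalForm a j (P 0) (P 1) ≠ 0) (s : ℕ) :
    s ∈ valueSet a P ↔ ∃ e, ∃ h ∈ sectionSpace a P Q ^ e, h.order = (s : ℕ∞) := by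
  constructor
  · rintro ⟨Q', j, G, hQ', hj, hG⟩
    obtain ⟨h, hh, hs⟩ := exists_order_subst_eq hj hG
    obtain ⟨h', hh', hs'⟩ := exists_mem_pow_order_eq a hQ hQ' hh
    exact ⟨s, h', hh', hs'.trans hs⟩
  · rintro ⟨e, h, hh, hs⟩
    obtain ⟨j, hj⟩ := ha
    obtain ⟨G, hG⟩ := exists_subst_of_mem_pow hj hh
    refine ⟨Q, j, G, hQ, hj, ?_⟩
    rwa [hG, PowerSeries.order_mul, order_localSection_pow hj, zero_add] at hs

theorem mem_vanishingOrders_iff {a : Fin (n + 1) × Fin (d + 1) → ℂ} {P Q : Fin 2 → ℂ}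
    (hQ : Indep P Q) (s : ℕ) :
    s ∈ vanishingOrders a P ↔ ∃ h ∈ sectionSpace a P Q, h.order = (s : ℕ∞) := by
  constructor
  · rintro ⟨Q', c, hQ', hs⟩
    obtain ⟨h', hh', hs'⟩ := exists_mem_pow_order_eq a hQ hQ' (e := 1)
      (h := ∑ i, c i • localSection a P Q' i) (by
        rw [pow_one]
        exact Submodule.sum_mem _ fun i _ => Submodule.smul_mem _ _
          (Submodule.subset_span ⟨i, rfl⟩))
    exact ⟨h', by simpa using hh', hs'.trans hs⟩
  · rintro ⟨h, hh, hs⟩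
    obtain ⟨c, rfl⟩ := (Submodule.mem_span_range_iff_exists_fun ℂ).1 hh
    exact ⟨Q, c, hQ, hs⟩

/-- The reversal of the coefficients, exchanging the two standard charts of the projective
line. -/
def chartPerm (d : ℕ) (ε : Bool) : Equiv.Perm (Fin (d + 1)) :=
  if ε then Fin.revPerm else Equiv.refl _

/-- The forms in a standard chart, at the point `p`. -/
def chartSection (ε : Bool) (a : Fin (n + 1) × Fin (d + 1) → ℂ) (p : ℂ) (i : Fin (n + 1)) :
    ℂ⟦X⟧ :=
  ∑ j : Fin (d + 1), PowerSeries.C (a (i, chartPerm d ε j)) *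
    (PowerSeries.C p + PowerSeries.X) ^ (j : ℕ)

/-- Scaling a representative of the point multiplies all forms by the same constant, so the section
space depends only on a chart and an affine coordinate `p`. Thus the point costs one parameter. -/
lemma exists_chart (a : Fin (n + 1) × Fin (d + 1) → ℂ) {P : Fin 2 → ℂ} (hP : P ≠ 0) :
    ∃ (ε : Bool) (p : ℂ) (Q : Fin 2 → ℂ), Indep P Q ∧
      sectionSpace a P Q = Submodule.span ℂ (Set.range (chartSection ε a p)) := by
  have hspan : ∀ (F F' : Fin (n + 1) → ℂ⟦X⟧) (μ : ℂ), μ ≠ 0 →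
      (∀ i, F i = PowerSeries.C μ * F' i) →
      Submodule.span ℂ (Set.range F) = Submodule.span ℂ (Set.range F') := by
    intro F F' μ hμ h
    refine le_antisymm (Submodule.span_le.2 ?_) (Submodule.span_le.2 ?_)
    · rintro _ ⟨i, rfl⟩
      rw [h, ← PowerSeries.smul_eq_C_mul]
      exact Submodule.smul_mem _ _ (Submodule.subset_span ⟨i, rfl⟩)
    · rintro _ ⟨i, rfl⟩
      have : F' i = μ⁻¹ • F i := by
        rw [h, ← PowerSeries.smul_eq_C_mul, smul_smul, inv_mul_cancel₀ hμ, one_smul]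
      rw [this]
      exact Submodule.smul_mem _ _ (Submodule.subset_span ⟨i, rfl⟩)
  by_cases hP1 : P 1 = 0
  · have hP0 : P 0 ≠ 0 := fun h => hP (by ext i; fin_cases i <;> simp [h, hP1])
    refine ⟨true, 0, ![0, P 0], by simp [Indep, hP0], hspan _ _ (P 0 ^ d) (pow_ne_zero _ hP0)
      fun i => ?_⟩
    have h1 := evalForm_mul a i (PowerSeries.C (P 0)) 1 PowerSeries.X
    rw [map_pow]
    convert h1 using 2
    · simp [localSection, hP1]
    · simp only [evalForm, chartSection, chartPerm, if_true]
      rw [← Equiv.sum_comp Fin.revPerm]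
      refine Finset.sum_congr rfl fun j _ => ?_
      simp [Fin.val_rev]
  · refine ⟨false, P 0 / P 1, ![P 1, 0], by simp [Indep, hP1], hspan _ _ (P 1 ^ d)
      (pow_ne_zero _ hP1) fun i => ?_⟩
    have h1 := evalForm_mul a i (PowerSeries.C (P 1)) (PowerSeries.C (P 0 / P 1) + PowerSeries.X) 1
    rw [map_pow]
    convert h1 using 2
    · simp only [localSection, Matrix.cons_val_zero, Matrix.cons_val_one]
      congr 1
      · rw [mul_add, ← map_mul, mul_div_cancel₀ _ hP1]
      · simp
    · simp only [evalForm, chartSection, chartPerm]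
      refine Finset.sum_congr rfl fun j _ => ?_
      simp

end Values

/-! ### Normal forms at the distinguished point. -/

section NormalForm

/-- `h` is a power series of order `s` with leading coefficient `1`. -/
def IsMonicOfOrder {R : Type} [Semiring R] (h : R⟦X⟧) (s : ℕ) : Prop :=
  (∀ r < s, PowerSeries.coeff r h = 0) ∧ PowerSeries.coeff s h = 1

/-- Gaussian elimination: coefficients at the orders occurring in `W` are cleared in increasing
position. Below `b`, only coefficients at positions outside `Ω` beyond `s` stay free. -/
lemma exists_reduced {W : Submodule ℂ ℂ⟦X⟧} {Ω : Set ℕ}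
    (hW : ∀ s ∈ Ω, ∃ h ∈ W, h.order = (s : ℕ∞)) {s : ℕ} (hs : s ∈ Ω) (b : ℕ) :
    ∃ h ∈ W, IsMonicOfOrder h s ∧ ∀ u ∈ Ω, s < u → u < b → PowerSeries.coeff u h = 0 := by
  have hmonic : ∀ s ∈ Ω, ∃ h ∈ W, IsMonicOfOrder h s := by
    intro s hs
    obtain ⟨h, hh, ho⟩ := hW s hs
    rw [PowerSeries.order_eq_nat] at ho
    refine ⟨(PowerSeries.coeff s h)⁻¹ • h, W.smul_mem _ hh, fun r hr => ?_, ?_⟩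
    · simp [ho.2 r hr]
    · simp [ho.1]
  induction b with
  | zero =>
    obtain ⟨h, hh, hm⟩ := hmonic s hs
    exact ⟨h, hh, hm, fun u _ _ hu => absurd hu (Nat.not_lt_zero _)⟩
  | succ b ih =>
    obtain ⟨h, hh, hm, hz⟩ := ih
    by_cases hb : b ∈ Ω ∧ s < b
    · obtain ⟨y, hy, hym⟩ := hmonic b hb.1
      refine ⟨h - PowerSeries.coeff b h • y, W.sub_mem hh (W.smul_mem _ hy), ⟨fun r hr => ?_, ?_⟩,
        fun u hu hsu hub => ?_⟩
      · simp [hm.1 r hr, hym.1 r (hr.trans hb.2)]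
      · simp [hm.2, hym.1 s hb.2]
      · rcases Nat.lt_succ_iff_lt_or_eq.1 hub with hub | rfl
        · simp [hz u hu hsu hub, hym.1 u hub]
        · simp [hym.2]
    · refine ⟨h, hh, hm, fun u hu hsu hub => ?_⟩
      rcases Nat.lt_succ_iff_lt_or_eq.1 hub with hub | rfl
      · exact hz u hu hsu hub
      · exact absurd ⟨hu, hsu⟩ hb

/-- Successive subtraction of leading terms: the order of every nonzero element of `W` lies in `Ω`,
so there is always some `m u` to subtract. The bound `b` makes the process finite. -/
lemma exists_expansion {W : Submodule ℂ ℂ⟦X⟧} {Ω : Set ℕ}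
    (hW : ∀ h ∈ W, ∀ s : ℕ, h.order = (s : ℕ∞) → s ∈ Ω) {b : ℕ} (m : ℕ → ℂ⟦X⟧)
    (hm : ∀ u ∈ Ω, u < b → m u ∈ W ∧ IsMonicOfOrder (m u) u) (q : ℕ) {h : ℂ⟦X⟧} (hh : h ∈ W)
    (hq : ∀ r < q, PowerSeries.coeff r h = 0) :
    ∃ c : ℕ → ℂ, ∀ r < b, PowerSeries.coeff r h =
      ∑ u ∈ (Finset.range b).filter (fun u => u ∈ Ω ∧ q ≤ u), c u * PowerSeries.coeff r (m u) := by
  by_cases hqb : b ≤ q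
  · refine ⟨0, fun r hr => ?_⟩
    rw [hq r (by omega)]
    simp
  · have hdec : b - (q + 1) < b - q := by omega
    by_cases h0 : PowerSeries.coeff q h = 0
    · obtain ⟨c, hc⟩ := exists_expansion hW m hm (q + 1) hh fun r hr => by
        rcases Nat.lt_succ_iff_lt_or_eq.1 hr with hr | rfl
        exacts [hq r hr, h0]
      refine ⟨fun u => if u = q then 0 else c u, fun r hr => ?_⟩
      rw [hc r hr]
      refine (Finset.sum_subset_zero_on_sdiff (fun u hu => ?_) (fun u hu => ?_) fun u hu => ?_)
      · simp only [Finset.mem_filter, Finset.mem_range] at hu ⊢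
        exact ⟨hu.1, hu.2.1, by omega⟩
      · simp only [Finset.mem_sdiff, Finset.mem_filter, Finset.mem_range, not_and, not_le] at hu
        have : u = q := by have := hu.2 hu.1.1 hu.1.2.1; omega
        simp [this]
      · simp only [Finset.mem_filter] at hu
        dsimp only
        rw [if_neg (by omega)]
    · have hqΩ : q ∈ Ω := hW h hh q (PowerSeries.order_eq_nat.2 ⟨h0, hq⟩)
      obtain ⟨hmW, hmq⟩ := hm q hqΩ (by omega)
      obtain ⟨c, hc⟩ := exists_expansion hW m hm (q + 1)
        (W.sub_mem hh (W.smul_mem (PowerSeries.coeff q h) hmW)) fun r hr => by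
          rcases Nat.lt_succ_iff_lt_or_eq.1 hr with hr | rfl
          · simp [hq r hr, hmq.1 r hr]
          · simp [hmq.2]
      refine ⟨fun u => if u = q then PowerSeries.coeff q h else c u, fun r hr => ?_⟩
      have h1 := hc r hr
      rw [map_sub, map_smul, smul_eq_mul, sub_eq_iff_eq_add] at h1
      have h2 : (Finset.range b).filter (fun u => u ∈ Ω ∧ q ≤ u) =
          insert q ((Finset.range b).filter (fun u => u ∈ Ω ∧ q + 1 ≤ u)) := by
        ext u
        simp only [Finset.mem_filter, Finset.mem_range, Finset.mem_insert]
        constructor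
        · rintro ⟨h1, h2, h3⟩
          rcases h3.eq_or_lt with h | h
          exacts [.inl h.symm, .inr ⟨h1, h2, h⟩]
        · rintro (rfl | h)
          exacts [⟨by omega, hqΩ, le_rfl⟩, ⟨h.1, h.2.1, by omega⟩]
      rw [h2, Finset.sum_insert (by simp)]
      dsimp only
      rw [if_pos rfl, h1, add_comm]
      congr 1
      refine Finset.sum_congr rfl fun u hu => ?_
      simp only [Finset.mem_filter] at hu
      rw [if_neg (by omega)]
termination_by b - q

/-- The ring of quotients `x = h / f ^ e` with `h` a combination of products of `e` elements of
`V`. -/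
def quotientRing (V : Submodule ℂ ℂ⟦X⟧) (f : ℂ⟦X⟧) (hf : f ∈ V) : Subalgebra ℂ ℂ⟦X⟧ where
  carrier := {x | ∃ e, x * f ^ e ∈ V ^ e}
  mul_mem' := by
    rintro x y ⟨e, hx⟩ ⟨e', hy⟩
    refine ⟨e + e', ?_⟩
    rw [pow_add, pow_add, mul_mul_mul_comm]
    exact Submodule.mul_mem_mul hx hy
  add_mem' := by
    rintro x y ⟨e, hx⟩ ⟨e', hy⟩
    refine ⟨e + e', ?_⟩
    have h1 := Submodule.mul_mem_mul hx (Submodule.pow_mem_pow V hf e')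
    have h2 := Submodule.mul_mem_mul hy (Submodule.pow_mem_pow V hf e)
    rw [← pow_add, mul_assoc, ← pow_add] at h1 h2
    rw [add_comm e' e] at h2
    rw [add_mul]
    exact Submodule.add_mem _ h1 h2
  algebraMap_mem' r := ⟨0, by
    rw [pow_zero f, mul_one, pow_zero V]
    exact Submodule.algebraMap_mem r⟩

variable {n : ℕ}

/-- Split `u` into minimal generators. Each is an entry of `k` or missing from it, and those that
occur are at most `u`, hence below `q`. -/
lemma exists_generation {S : AddSubmonoid ℕ} {k : Fin (n + 1) → ℕ} (hk0 : k 0 = 0) {q : ℕ}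
    (hq : q ≤ conductor S) (u : ℕ) (hu : u ∈ S) (huq : u < q) :
    ∃ (w : Fin n → ℕ) (e : ℕ → ℕ),
      u = value k w + ∑ s ∈ (missingGenerators S k).filter (· < q), e s * s := by
  induction u using Nat.strong_induction_on with
  | _ u ih =>
  by_cases hu0 : u = 0
  · exact ⟨0, 0, by simp [value, hu0]⟩
  by_cases hgen : IsMinimalGenerator S u
  · by_cases huk : u ∈ Set.range k
    · obtain ⟨l, rfl⟩ := huk
      obtain ⟨i, rfl⟩ := Fin.exists_succ_eq.2 (fun h : l = 0 => hu0 (h ▸ hk0))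
      exact ⟨Pi.single i 1, 0, by simp [value_single]⟩
    · refine ⟨0, Pi.single u 1, ?_⟩
      rw [Finset.sum_eq_single u]
      · simp [value]
      · intro s _ hs
        simp [hs]
      · intro h
        exact absurd (Finset.mem_filter.2 ⟨Finset.mem_filter.2
          ⟨Finset.mem_range.2 (huq.trans_le hq), hgen, huk⟩, huq⟩) h
  · simp only [IsMinimalGenerator, not_and, not_forall, not_or] at hgen
    obtain ⟨a, ha, b, hb, hab, ha0, hb0⟩ := hgen hu hu0
    obtain ⟨w, e, hwe⟩ := ih a (by omega) ha (by omega)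
    obtain ⟨w', e', hwe'⟩ := ih b (by omega) hb (by omega)
    refine ⟨w + w', e + e', ?_⟩
    rw [value_add]
    simp only [Pi.add_apply, add_mul, Finset.sum_add_distrib]
    omega

lemma IsMonicOfOrder.mul {R : Type} [CommSemiring R] {x y : R⟦X⟧} {s t : ℕ}
    (hx : IsMonicOfOrder x s) (hy : IsMonicOfOrder y t) : IsMonicOfOrder (x * y) (s + t) := by
  obtain ⟨x', rfl⟩ := PowerSeries.X_pow_dvd_iff.2 hx.1
  obtain ⟨y', rfl⟩ := PowerSeries.X_pow_dvd_iff.2 hy.1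
  have hx2 := hx.2
  have hy2 := hy.2
  have h := PowerSeries.coeff_X_pow_mul x' s 0
  have h' := PowerSeries.coeff_X_pow_mul y' t 0
  rw [zero_add] at h h'
  rw [h] at hx2
  rw [h'] at hy2
  have heq : PowerSeries.X ^ s * x' * (PowerSeries.X ^ t * y') =
    PowerSeries.X ^ (s + t) * (x' * y') := by ring
  rw [heq]
  refine ⟨PowerSeries.X_pow_dvd_iff.1 (dvd_mul_right _ _), ?_⟩
  have := PowerSeries.coeff_X_pow_mul (x' * y') (s + t) 0
  rw [zero_add] at this
  rw [PowerSeries.coeff_zero_eq_constantCoeff_apply] at hx2 hy2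
  rw [this, PowerSeries.coeff_zero_eq_constantCoeff_apply, map_mul, hx2, hy2, one_mul]

lemma IsMonicOfOrder.one {R : Type} [CommSemiring R] : IsMonicOfOrder (1 : R⟦X⟧) 0 :=
  ⟨fun _ h => absurd h (Nat.not_lt_zero _), by simp⟩

lemma IsMonicOfOrder.pow {R : Type} [CommSemiring R] {x : R⟦X⟧} {s : ℕ}
    (hx : IsMonicOfOrder x s) (m : ℕ) : IsMonicOfOrder (x ^ m) (m * s) := by
  induction m with
  | zero => simpa using IsMonicOfOrder.one
  | succ m ih => rw [pow_succ, Nat.succ_mul]; exact ih.mul hx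

lemma IsMonicOfOrder.prod {R ι : Type} [CommSemiring R] {T : Finset ι} {x : ι → R⟦X⟧}
    {s m : ι → ℕ} (hx : ∀ i ∈ T, IsMonicOfOrder (x i) (s i)) :
    IsMonicOfOrder (∏ i ∈ T, x i ^ m i) (∑ i ∈ T, m i * s i) := by
  induction T using Finset.induction_on with
  | empty => simpa using IsMonicOfOrder.one
  | insert i T hi ih =>
    rw [Finset.prod_insert hi, Finset.sum_insert hi]
    exact ((hx i (Finset.mem_insert_self _ _)).pow _).mul
      (ih fun j hj => hx j (Finset.mem_insert_of_mem hj))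

/-- The monomial with exponent vector `v`. -/
def monom {R : Type} [CommSemiring R] (f : Fin n → R⟦X⟧) (v : Fin n → ℕ) : R⟦X⟧ := ∏ i, f i ^ v i

/-- The monomial with exponents `w` in the `f i` and `e` in the `G s`. -/
def mixedMonom {R : Type} [CommSemiring R] (f : Fin n → R⟦X⟧) (T : Finset ℕ) (G : ℕ → R⟦X⟧)
    (w : Fin n → ℕ) (e : ℕ → ℕ) : R⟦X⟧ :=
  monom f w * ∏ s ∈ T, G s ^ e s

/-- A normal form of a morphism at a point, relative to a cutoff `q` and chosen decompositions
`w u`, `e u` of the elements `u` of `S`: an echelon basis `F` of the space of sections, its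
dehomogenization `f`, elements `G s` of the local ring for the missing generators `s`, and
expansions of the syzygies of the `f i`. -/
structure IsNormalForm {R : Type} [CommRing R] (d q : ℕ) (S : AddSubmonoid ℕ)
    (k : Fin (n + 1) → ℕ) (Y : Finset (Σ _ : ℕ, Fin n → ℕ)) (ref : ℕ → Fin n → ℕ)
    (w : ℕ → Fin n → ℕ) (e : ℕ → ℕ → ℕ) (F : Fin (n + 1) → R⟦X⟧) (f : Fin n → R⟦X⟧)
    (G : ℕ → R⟦X⟧) (c : (Σ _ : ℕ, Fin n → ℕ) → ℕ → R) : Prop where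
  monic : ∀ l, IsMonicOfOrder (F l) (k l)
  echelon : ∀ l l', l ≠ l' → PowerSeries.coeff (k l') (F l) = 0
  degree : ∀ l r, d < r → PowerSeries.coeff r (F l) = 0
  dehomogenize : ∀ i, F (Fin.succ i) = F 0 * f i
  generator_monic : ∀ s ∈ (missingGenerators S k).filter (· < q), IsMonicOfOrder (G s) s
  generator_reduced : ∀ s ∈ (missingGenerators S k).filter (· < q), ∀ u ∈ S, s < u → u < q →
    PowerSeries.coeff u (G s) = 0
  syzygy : ∀ σ ∈ Y, ∀ r < q, PowerSeries.coeff r (monom f σ.2) =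
    PowerSeries.coeff r (monom f (ref σ.1)) +
      ∑ u ∈ (Finset.range q).filter (fun u => u ∈ S ∧ σ.1 + 1 ≤ u), c σ u *
        PowerSeries.coeff r (mixedMonom f ((missingGenerators S k).filter (· < q)) G (w u) (e u))

lemma coeff_chartSection_of_lt {d : ℕ} (ε : Bool) (a : Fin (n + 1) × Fin (d + 1) → ℂ) (p : ℂ)
    (i : Fin (n + 1)) {r : ℕ} (hr : d < r) : PowerSeries.coeff r (chartSection ε a p i) = 0 := by
  have : chartSection ε a p i = ((∑ j : Fin (d + 1), Polynomial.C (a (i, chartPerm d ε j)) *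
      (Polynomial.X + Polynomial.C p) ^ (j : ℕ) : Polynomial ℂ) : ℂ⟦X⟧) := by
    have := map_sum (Polynomial.coeToPowerSeries.ringHom (R := ℂ))
      (fun j : Fin (d + 1) => Polynomial.C (a (i, chartPerm d ε j)) *
        (Polynomial.X + Polynomial.C p) ^ (j : ℕ)) Finset.univ
    simp only [Polynomial.coeToPowerSeries.ringHom_apply] at this
    rw [this, chartSection]
    simp [add_comm]
  rw [this, Polynomial.coeff_coe]
  refine Polynomial.coeff_eq_zero_of_natDegree_lt (lt_of_le_of_lt
    (Polynomial.natDegree_sum_le_of_forall_le _ _ fun j _ => ?_) hr)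
  refine (Polynomial.natDegree_C_mul_le _ _).trans ((Polynomial.natDegree_pow_le).trans ?_)
  rw [Polynomial.natDegree_X_add_C, mul_one]
  exact Nat.lt_succ_iff.1 j.2

theorem exists_normalForm {d q : ℕ} {S : AddSubmonoid ℕ} {k : Fin (n + 1) → ℕ} (hk0 : k 0 = 0)
    (hk : StrictMono k) {Y : Finset (Σ _ : ℕ, Fin n → ℕ)} {ref : ℕ → Fin n → ℕ}
    (hY : ∀ σ ∈ Y, value k σ.2 = σ.1 ∧ value k (ref σ.1) = σ.1)
    {w : ℕ → Fin n → ℕ} {e : ℕ → ℕ → ℕ}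
    (hwe : ∀ u ∈ S, u < q →
      u = value k (w u) + ∑ s ∈ (missingGenerators S k).filter (· < q), e u s * s)
    {a : Fin (n + 1) × Fin (d + 1) → ℂ} (ha : a ∈ stratum d S k) :
    (∀ l, k l ∈ S ∧ k l ≤ d) ∧ ∃ (ε : Bool) (p : ℂ) (g : Fin (n + 1) → Fin (n + 1) → ℂ)
      (F : Fin (n + 1) → ℂ⟦X⟧) (f : Fin n → ℂ⟦X⟧) (G : ℕ → ℂ⟦X⟧)
      (c : (Σ _ : ℕ, Fin n → ℕ) → ℕ → ℂ),
      (∀ i, chartSection ε a p i = ∑ l, PowerSeries.C (g i l) * F l) ∧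
      IsNormalForm d q S k Y ref w e F f G c := by
  obtain ⟨⟨-, hbase⟩, -, P, hP, hval, hvan, -⟩ := ha
  obtain ⟨ε, p, Q, hQ, hspan⟩ := exists_chart a hP
  set V := Submodule.span ℂ (Set.range (chartSection ε a p)) with hV
  have hval' : ∀ s : ℕ, s ∈ S ↔ ∃ e, ∃ h ∈ V ^ e, h.order = (s : ℕ∞) := by
    intro s
    rw [← hspan, ← mem_valueSet_iff hQ (hbase P hP), hval]
    rfl
  have hvan' : ∀ s : ℕ, s ∈ Set.range k ↔ ∃ h ∈ V, h.order = (s : ℕ∞) := by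
    intro s
    rw [← hspan, ← mem_vanishingOrders_iff hQ, hvan]
  have hdeg : ∀ h ∈ V, ∀ r, d < r → PowerSeries.coeff r h = 0 := by
    intro h hh r hr
    induction hh using Submodule.span_induction with
    | mem x hx =>
      obtain ⟨i, rfl⟩ := hx
      exact coeff_chartSection_of_lt ε a p i hr
    | zero => simp
    | add x y _ _ hx hy => simp [hx, hy]
    | smul c x _ hx => simp [hx]
  -- The sections are polynomials of degree at most `d`, so reduction below `d + 1` gives the full
  -- reduced echelon basis.
  choose F hFV hFm hFr using fun l => exists_reduced (W := V) (Ω := Set.range k)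
    (fun s hs => (hvan' s).1 hs) (Set.mem_range_self l) (d + 1)
  have hkd : ∀ l, k l ≤ d := by
    intro l
    by_contra h
    have h1 := (hFm l).2
    rw [hdeg _ (hFV l) _ (not_le.1 h)] at h1
    exact zero_ne_one h1
  have hkS : ∀ l, k l ∈ S := fun l => (hval' _).2 ⟨1, F l, by rw [pow_one]; exact hFV l,
    PowerSeries.order_eq_nat.2 ⟨by rw [(hFm l).2]; exact one_ne_zero, (hFm l).1⟩⟩
  have hF0 : PowerSeries.constantCoeff (F 0) = 1 := by
    have := (hFm 0).2
    rwa [hk0, PowerSeries.coeff_zero_eq_constantCoeff_apply] at this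
  have hF0inv : F 0 * (F 0)⁻¹ = 1 := PowerSeries.mul_inv_cancel _ (by rw [hF0]; exact one_ne_zero)
  have hF0u : IsUnit (F 0) := IsUnit.of_mul_eq_one _ hF0inv
  have hF0m : IsMonicOfOrder (F 0)⁻¹ 0 := by
    refine ⟨fun r hr => absurd hr (Nat.not_lt_zero _), ?_⟩
    have := congrArg PowerSeries.constantCoeff hF0inv
    rw [map_mul, hF0, one_mul, map_one] at this
    rwa [PowerSeries.coeff_zero_eq_constantCoeff_apply]
  let A := quotientRing V (F 0) (hFV 0)
  have hAS : ∀ x ∈ Subalgebra.toSubmodule A, ∀ s : ℕ, x.order = (s : ℕ∞) → s ∈ (S : Set ℕ) := by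
    rintro x ⟨m, hm⟩ s hs
    refine (hval' s).2 ⟨m, _, hm, ?_⟩
    rw [PowerSeries.order_mul, hs, PowerSeries.order_zero_of_unit (hF0u.pow m), add_zero]
  have hSA : ∀ s ∈ (S : Set ℕ), ∃ x ∈ Subalgebra.toSubmodule A, x.order = (s : ℕ∞) := by
    intro s hs
    obtain ⟨m, h, hh, ho⟩ := (hval' s).1 hs
    have h1 : h * (F 0)⁻¹ ^ m * F 0 ^ m = h := by
      rw [mul_assoc, ← mul_pow, mul_comm (F 0)⁻¹, hF0inv, one_pow, mul_one]
    refine ⟨h * (F 0)⁻¹ ^ m, ⟨m, by rw [h1]; exact hh⟩, ?_⟩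
    rw [← ho, ← congrArg PowerSeries.order h1, PowerSeries.order_mul _ (F 0 ^ m),
      PowerSeries.order_zero_of_unit (hF0u.pow m), add_zero]
  set f : Fin n → ℂ⟦X⟧ := fun i => F i.succ * (F 0)⁻¹ with hf
  have hfm : ∀ i, IsMonicOfOrder (f i) (k i.succ) := fun i => (hFm i.succ).mul hF0m
  have hfA : ∀ i, f i ∈ A := by
    intro i
    refine ⟨1, ?_⟩
    rw [pow_one, pow_one, hf, mul_assoc, mul_comm (F 0)⁻¹, hF0inv, mul_one]
    exact hFV _
  set T := (missingGenerators S k).filter (· < q)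
  have hTS : ∀ s ∈ T, s ∈ (S : Set ℕ) := fun s hs =>
    (Finset.mem_filter.1 (Finset.mem_filter.1 hs).1).2.1.1
  choose! G hGA hGm hGr using fun s (hs : s ∈ (S : Set ℕ)) => exists_reduced hSA hs q
  have hmonA : ∀ v, monom f v ∈ A := fun v => A.prod_mem fun i _ => A.pow_mem (hfA i) _
  have hmonm : ∀ v, IsMonicOfOrder (monom f v) (value k v) := fun v =>
    IsMonicOfOrder.prod fun i _ => hfm i
  have hmix : ∀ u ∈ (S : Set ℕ), u < q → mixedMonom f T G (w u) (e u) ∈ Subalgebra.toSubmodule A ∧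
      IsMonicOfOrder (mixedMonom f T G (w u) (e u)) u := by
    intro u hu huq
    refine ⟨A.mul_mem (hmonA _) (A.prod_mem fun s hs => A.pow_mem (hGA s (hTS s hs)) _), ?_⟩
    have h1 := (hmonm (w u)).mul (IsMonicOfOrder.prod (m := e u) fun s hs => hGm s (hTS s hs))
    rw [← hwe u hu huq] at h1
    exact h1
  have hsyz : ∀ σ ∈ Y, ∃ c : ℕ → ℂ, ∀ r < q,
      PowerSeries.coeff r (monom f σ.2 - monom f (ref σ.1)) =
        ∑ u ∈ (Finset.range q).filter (fun u => u ∈ (S : Set ℕ) ∧ σ.1 + 1 ≤ u),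
          c u * PowerSeries.coeff r (mixedMonom f T G (w u) (e u)) := by
    intro σ hσ
    -- Both monomials are monic of order `s`, so their leading terms cancel and the expansion starts
    -- at `s + 1`.
    refine exists_expansion hAS _ hmix (σ.1 + 1) (A.sub_mem (hmonA _) (hmonA _)) fun r hr => ?_
    have h1 := hmonm σ.2
    have h2 := hmonm (ref σ.1)
    rw [(hY σ hσ).1] at h1
    rw [(hY σ hσ).2] at h2
    rcases Nat.lt_succ_iff_lt_or_eq.1 hr with hr | rfl
    · rw [map_sub, h1.1 r hr, h2.1 r hr, sub_zero]
    · rw [map_sub, h1.2, h2.2, sub_self]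
  choose! c hc using hsyz
  -- `exists_expansion` indexes its basis by orders, so `F` is reindexed by the values of `k`;
  -- injectivity of `k` later undoes this.
  have hm : ∀ u ∈ Set.range k, u < d + 1 →
      (if h : u ∈ Set.range k then F h.choose else 0) ∈ V ∧
      IsMonicOfOrder (if h : u ∈ Set.range k then F h.choose else 0) u := by
    intro u hu _
    rw [dif_pos hu]
    refine ⟨hFV _, ?_⟩
    have := hFm hu.choose
    rwa [hu.choose_spec] at this
  have hexp := fun i => exists_expansion (W := V) (Ω := Set.range k) (b := d + 1)
    (fun h hh s hs => (hvan' s).2 ⟨h, hh, hs⟩)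
    (fun u => if h : u ∈ Set.range k then F h.choose else 0) hm 0
    (Submodule.subset_span ⟨i, rfl⟩ : chartSection ε a p i ∈ V)
    fun r hr => absurd hr (Nat.not_lt_zero _)
  choose g hg using hexp
  refine ⟨fun l => ⟨hkS l, hkd l⟩, ε, p, fun i l => g i (k l), F, f, G, c, fun i => ?_, ?_⟩
  · ext r
    have hR : PowerSeries.coeff r (∑ l, PowerSeries.C (g i (k l)) * F l) =
        ∑ l, g i (k l) * PowerSeries.coeff r (F l) := by
      simp [map_sum]
    rw [hR]
    by_cases hr : r < d + 1
    · rw [hg i r hr]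
      refine (Finset.sum_bij (fun l _ => k l) (fun l _ => ?_) (fun l _ l' _ h => hk.injective h)
        (fun u hu => ?_) fun l _ => ?_).symm
      · simp only [Finset.mem_filter, Finset.mem_range, Set.mem_range_self, zero_le,
          and_true]
        exact Nat.lt_succ_iff.2 (hkd l)
      · simp only [Finset.mem_filter] at hu
        obtain ⟨-, ⟨l, hl⟩, -⟩ := hu
        exact ⟨l, Finset.mem_univ _, hl⟩
      · have h : k l ∈ Set.range k := ⟨l, rfl⟩
        rw [dif_pos h, hk.injective h.choose_spec]
    · rw [coeff_chartSection_of_lt ε a p i (by omega), Finset.sum_eq_zero fun l _ => by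
        rw [hdeg _ (hFV l) r (by omega), mul_zero]]
  · refine ⟨hFm, fun l l' hl => ?_, fun l r hr => hdeg _ (hFV l) r hr, fun i => ?_,
      fun s hs => hGm s (hTS s hs), fun s hs u hu hsu huq => hGr s (hTS s hs) u hu hsu huq,
      fun σ hσ r hr => ?_⟩
    · rcases lt_or_gt_of_ne hl with h | h
      · exact hFr l (k l') ⟨l', rfl⟩ (hk h) (Nat.lt_succ_iff.2 (hkd l'))
      · exact (hFm l).1 _ (hk h)
    · rw [hf, mul_left_comm, hF0inv, mul_one]
    · have := hc σ hσ r hr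
      rw [map_sub, sub_eq_iff_eq_add'] at this
      exact this

end NormalForm

/-! ### Eliminating coefficients weight by weight. -/

section Elimination

variable {L : Type} [Field L] {K : Subfield L}

/-- `x` has constant coefficient `1` and its coefficients below `t` lie in `K`. -/
def IsUnitBelow (K : Subfield L) (t : ℕ) (x : L⟦X⟧) : Prop :=
  PowerSeries.constantCoeff x = 1 ∧ ∀ r < t, PowerSeries.coeff r x ∈ K

namespace IsUnitBelow

variable {t : ℕ} {x y : L⟦X⟧}

lemma mono {t' : ℕ} (hx : IsUnitBelow K t x) (h : t' ≤ t) : IsUnitBelow K t' x :=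
  ⟨hx.1, fun r hr => hx.2 r (hr.trans_le h)⟩

lemma one : IsUnitBelow K t 1 :=
  ⟨map_one _, fun r _ => by
    rw [PowerSeries.coeff_one]
    split_ifs
    exacts [K.one_mem, K.zero_mem]⟩

lemma mul (hx : IsUnitBelow K t x) (hy : IsUnitBelow K t y) : IsUnitBelow K t (x * y) := by
  refine ⟨by rw [map_mul, hx.1, hy.1, one_mul], fun r hr => ?_⟩
  rw [PowerSeries.coeff_mul]
  refine K.sum_mem fun m hm => ?_
  rw [Finset.HasAntidiagonal.mem_antidiagonal] at hm
  exact K.mul_mem (hx.2 _ (by omega)) (hy.2 _ (by omega))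

/-- To first order, products become sums. -/
lemma coeff_mul_sub_mem (ht : t ≠ 0) (hx : IsUnitBelow K t x) (hy : IsUnitBelow K t y) :
    PowerSeries.coeff t (x * y) - (PowerSeries.coeff t x + PowerSeries.coeff t y) ∈ K := by
  have h0 := hx.1
  have h0' := hy.1
  rw [← PowerSeries.coeff_zero_eq_constantCoeff_apply] at h0 h0'
  have hne : ((0 : ℕ), t) ≠ (t, 0) := fun h => ht (congrArg Prod.snd h)
  have hsub : ({(0, t), (t, 0)} : Finset (ℕ × ℕ)) ⊆ Finset.HasAntidiagonal.antidiagonal t := by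
    intro m hm
    simp only [Finset.mem_insert, Finset.mem_singleton] at hm
    rcases hm with rfl | rfl <;> simp
  rw [PowerSeries.coeff_mul, ← Finset.sum_sdiff hsub, Finset.sum_pair hne, h0, h0', one_mul,
    mul_one, add_comm (PowerSeries.coeff t y), add_sub_cancel_right]
  refine K.sum_mem fun m hm => ?_
  simp only [Finset.mem_sdiff, Finset.HasAntidiagonal.mem_antidiagonal, Finset.mem_insert, Finset.mem_singleton,
    Prod.ext_iff] at hm
  exact K.mul_mem (hx.2 _ (by omega)) (hy.2 _ (by omega))

lemma pow (hx : IsUnitBelow K t x) (m : ℕ) : IsUnitBelow K t (x ^ m) := by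
  induction m with
  | zero => rw [pow_zero]; exact one
  | succ m ih => rw [pow_succ]; exact ih.mul hx

lemma coeff_pow_sub_mem (ht : t ≠ 0) (hx : IsUnitBelow K t x) (m : ℕ) :
    PowerSeries.coeff t (x ^ m) - m * PowerSeries.coeff t x ∈ K := by
  induction m with
  | zero => simp [PowerSeries.coeff_one, ht, K.zero_mem]
  | succ m ih =>
    rw [pow_succ]
    have := K.add_mem ((hx.pow m).coeff_mul_sub_mem ht hx) ih
    convert this using 1
    push_cast
    ring

lemma prod_pow {ι : Type} {T : Finset ι} {x : ι → L⟦X⟧} {m : ι → ℕ}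
    (hx : ∀ i ∈ T, m i ≠ 0 → IsUnitBelow K t (x i)) :
    IsUnitBelow K t (∏ i ∈ T, x i ^ m i) := by
  induction T using Finset.induction_on with
  | empty => exact one
  | insert i T hi ih =>
    rw [Finset.prod_insert hi]
    refine mul ?_ (ih fun j hj => hx j (Finset.mem_insert_of_mem hj))
    by_cases hm : m i = 0
    · rw [hm, pow_zero]; exact one
    · exact (hx i (Finset.mem_insert_self _ _) hm).pow _

lemma coeff_prod_pow_sub_mem (ht : t ≠ 0) {ι : Type} {T : Finset ι} {x : ι → L⟦X⟧} (m : ι → ℕ)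
    (hx : ∀ i ∈ T, IsUnitBelow K t (x i)) :
    PowerSeries.coeff t (∏ i ∈ T, x i ^ m i) - ∑ i ∈ T, m i * PowerSeries.coeff t (x i) ∈ K := by
  induction T using Finset.induction_on with
  | empty => simp [PowerSeries.coeff_one, ht, K.zero_mem]
  | insert i T hi ih =>
    rw [Finset.prod_insert hi, Finset.sum_insert hi]
    have hxT := fun j hj => hx j (Finset.mem_insert_of_mem hj)
    have hxi := hx i (Finset.mem_insert_self _ _)
    have := K.add_mem (K.add_mem ((hxi.pow (m i)).coeff_mul_sub_mem ht
      (prod_pow (m := m) fun j hj _ => hxT j hj)) (hxi.coeff_pow_sub_mem ht (m i))) (ih hxT)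
    convert this using 1
    ring

end IsUnitBelow

lemma IsMonicOfOrder.exists_unit {x : L⟦X⟧} {s : ℕ} (hx : IsMonicOfOrder x s) :
    ∃ u : L⟦X⟧, x = PowerSeries.X ^ s * u ∧ PowerSeries.constantCoeff u = 1 := by
  obtain ⟨u, rfl⟩ := PowerSeries.X_pow_dvd_iff.2 hx.1
  refine ⟨u, rfl, ?_⟩
  have h := PowerSeries.coeff_X_pow_mul u s 0
  rw [zero_add, hx.2, PowerSeries.coeff_zero_eq_constantCoeff_apply] at h
  exact h.symm

lemma coeff_X_pow_mul_of_le {s r : ℕ} (u : L⟦X⟧) (h : s ≤ r) :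
    PowerSeries.coeff r (PowerSeries.X ^ s * u) = PowerSeries.coeff (r - s) u := by
  obtain ⟨m, rfl⟩ := Nat.exists_eq_add_of_le' h
  rw [PowerSeries.coeff_X_pow_mul, Nat.add_sub_cancel]

variable {n : ℕ}

lemma prod_X_pow_mul_pow {ι : Type} (T : Finset ι) (s m : ι → ℕ) (u : ι → L⟦X⟧) :
    ∏ i ∈ T, (PowerSeries.X ^ s i * u i) ^ m i =
      PowerSeries.X ^ (∑ i ∈ T, m i * s i) * ∏ i ∈ T, u i ^ m i := by
  rw [← Finset.prod_pow_eq_pow_sum, ← Finset.prod_mul_distrib]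
  refine Finset.prod_congr rfl fun i _ => ?_
  rw [mul_pow, ← pow_mul, mul_comm (s i)]

variable {d q : ℕ} {S : AddSubmonoid ℕ} {k : Fin (n + 1) → ℕ}
  {I : ℕ → Finset (Fin n → ℕ)} {ref : ℕ → Fin n → ℕ} {w : ℕ → Fin n → ℕ} {e : ℕ → ℕ → ℕ}
  {F : Fin (n + 1) → L⟦X⟧} {f : Fin n → L⟦X⟧} {G : ℕ → L⟦X⟧}
  {c : (Σ _ : ℕ, Fin n → ℕ) → ℕ → L}

/-- In a normal form, the coefficients of the sections at the pivots are determined by the other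
coefficients and the coefficients of the `G s`. -/
theorem IsNormalForm.coeff_mem [CharZero L] (hk0 : k 0 = 0)
    (hN : IsNormalForm d q S k (syzygies S I ref) ref w e F f G c)
    (hY : ∀ σ ∈ syzygies S I ref, value k σ.2 = σ.1 ∧ value k (ref σ.1) = σ.1)
    (hwe : ∀ u ∈ S, u < q →
      u = value k (w u) + ∑ s ∈ (missingGenerators S k).filter (· < q), e u s * s)
    {E : ℕ → Finset (Fin n)}
    (hE : ∀ j, ∀ i ∈ E j, ∃ v ∈ activeSpan S I ref q j, v i = 1 ∧ ∀ i' ∈ E j, i' ≠ i → v i' = 0)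
    (hF0 : ∀ r, PowerSeries.coeff r (F 0) ∈ K)
    (hF : ∀ i j, 1 ≤ j → i ∉ E j → PowerSeries.coeff (k (Fin.succ i) + j) (F i.succ) ∈ K)
    (hG : ∀ s ∈ (missingGenerators S k).filter (· < q), ∀ r < q,
      PowerSeries.coeff r (G s) ∈ K) (l : Fin (n + 1)) (r : ℕ) :
    PowerSeries.coeff r (F l) ∈ K := by
  set T := (missingGenerators S k).filter (· < q)
  have hF0c : PowerSeries.constantCoeff (F 0) = 1 := by
    have := (hN.monic 0).2
    rwa [hk0, PowerSeries.coeff_zero_eq_constantCoeff_apply] at this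
  choose uF huF huF1 using fun l => (hN.monic l).exists_unit
  choose! uG huG huG1 using fun s (hs : s ∈ T) => (hN.generator_monic s hs).exists_unit
  have hF0inv : F 0 * (F 0)⁻¹ = 1 := PowerSeries.mul_inv_cancel _ (by rw [hF0c]; exact one_ne_zero)
  set u : Fin n → L⟦X⟧ := fun i => (F 0)⁻¹ * uF i.succ with hu
  have hFu : ∀ i : Fin n, uF i.succ = F 0 * u i := fun i => by
    rw [hu]; simp only; rw [← mul_assoc, hF0inv, one_mul]
  have hfu : ∀ i, f i = PowerSeries.X ^ k i.succ * u i := by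
    intro i
    have h1 := hN.dehomogenize i
    rw [huF i.succ] at h1
    calc f i = (F 0)⁻¹ * (F 0 * f i) := by rw [← mul_assoc, mul_comm (F 0)⁻¹, hF0inv, one_mul]
      _ = _ := by rw [← h1, hu]; ring
  have hu1 : ∀ i, PowerSeries.constantCoeff (u i) = 1 := by
    intro i
    have := congrArg PowerSeries.constantCoeff (hFu i)
    rw [map_mul, hF0c, one_mul, huF1] at this
    exact this.symm
  have hmonom : ∀ v, monom f v = PowerSeries.X ^ value k v * ∏ i, u i ^ v i := by
    intro v
    rw [monom, value, ← prod_X_pow_mul_pow]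
    exact Finset.prod_congr rfl fun i _ => by rw [hfu]
  have hmixed : ∀ t ∈ S, t < q → mixedMonom f T G (w t) (e t) =
      PowerSeries.X ^ t * ((∏ i, u i ^ w t i) * ∏ s ∈ T, uG s ^ e t s) := by
    intro t ht htq
    have h1 : ∏ s ∈ T, G s ^ e t s =
        PowerSeries.X ^ (∑ s ∈ T, e t s * s) * ∏ s ∈ T, uG s ^ e t s := by
      rw [← prod_X_pow_mul_pow]
      exact Finset.prod_congr rfl fun s hs => by rw [← huG s hs]
    rw [mixedMonom, hmonom, h1]
    conv_rhs => rw [hwe t ht htq, ← hwe t ht htq]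
    calc _ = (PowerSeries.X ^ value k (w t) * PowerSeries.X ^ (∑ s ∈ T, e t s * s)) *
        ((∏ i, u i ^ w t i) * ∏ s ∈ T, uG s ^ e t s) := by ring
      _ = _ := by rw [← pow_add, ← hwe t ht htq]
  have hGu : ∀ s ∈ T, ∀ t, s + t ≤ q → IsUnitBelow K t (uG s) := by
    intro s hs t hst
    refine ⟨huG1 s hs, fun r hr => ?_⟩
    have := hG s hs (s + r) (by omega)
    rwa [huG s hs, coeff_X_pow_mul_of_le _ (Nat.le_add_right _ _), Nat.add_sub_cancel_left] at this
  -- Simultaneous induction on the weight `j`. At `s + j`, a gap gives a linear relation between the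
  -- `j`-th coefficients of the `u i`, while an element of `S` determines the expansion coefficient
  -- `c σ (s + j)`, which is needed in higher weights.
  have key : ∀ j, (∀ i, PowerSeries.coeff j (u i) ∈ K) ∧
      ∀ σ ∈ syzygies S I ref, σ.1 + j ∈ S → 1 ≤ j → σ.1 + j < q → c σ (σ.1 + j) ∈ K := by
    intro j
    induction j using Nat.strong_induction_on with
    | _ j ih =>
    by_cases hj : j = 0
    · subst hj
      refine ⟨fun i => ?_, fun σ _ _ h => absurd h (by omega)⟩
      rw [PowerSeries.coeff_zero_eq_constantCoeff_apply, hu1]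
      exact K.one_mem
    have hub : ∀ i, IsUnitBelow K j (u i) := fun i => ⟨hu1 i, fun r hr => (ih r hr).1 i⟩
    have hcoef : ∀ v, PowerSeries.coeff (value k v + j) (monom f v) -
        ∑ i, (v i : L) * PowerSeries.coeff j (u i) ∈ K := by
      intro v
      rw [hmonom, coeff_X_pow_mul_of_le _ (Nat.le_add_right _ _), Nat.add_sub_cancel_left]
      exact IsUnitBelow.coeff_prod_pow_sub_mem hj v fun i _ => hub i
    have hsyz : ∀ σ ∈ syzygies S I ref, σ.1 + j < q →
        ∑ i, ((σ.2 i : L) - ref σ.1 i) * PowerSeries.coeff j (u i) -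
          (if σ.1 + j ∈ S then c σ (σ.1 + j) else 0) ∈ K := by
      intro σ hσ hσq
      have h1 := hN.syzygy σ hσ (σ.1 + j) hσq
      have h2 := hcoef σ.2
      have h3 := hcoef (ref σ.1)
      rw [(hY σ hσ).1] at h2
      rw [(hY σ hσ).2] at h3
      -- Terms of order `t > s + j` do not contribute, and `t = s + j` contributes exactly `c σ t`.
      -- For `t = s + j'` with `1 ≤ j' < j`, only unit coefficients up to weight `j - j' < j` enter,
      -- all known by induction.
      have h4 : ∑ t ∈ (Finset.range q).filter (fun t => t ∈ S ∧ σ.1 + 1 ≤ t), c σ t *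
          PowerSeries.coeff (σ.1 + j) (mixedMonom f T G (w t) (e t)) -
          (if σ.1 + j ∈ S then c σ (σ.1 + j) else 0) ∈ K := by
        have h5 : (if σ.1 + j ∈ S then c σ (σ.1 + j) else 0) =
            ∑ t ∈ (Finset.range q).filter (fun t => t ∈ S ∧ σ.1 + 1 ≤ t),
              if t = σ.1 + j then c σ t else 0 := by
          rw [Finset.sum_ite_eq']
          refine if_congr ?_ rfl rfl
          simp only [Finset.mem_filter, Finset.mem_range]
          exact ⟨fun h => ⟨hσq, h, by omega⟩, fun h => h.2.1⟩
        rw [h5, ← Finset.sum_sub_distrib]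
        refine K.sum_mem fun t ht => ?_
        simp only [Finset.mem_filter, Finset.mem_range] at ht
        obtain ⟨htq, htS, hσt⟩ := ht
        rw [hmixed t htS htq]
        rcases lt_trichotomy t (σ.1 + j) with h | rfl | h
        · rw [if_neg (by omega), sub_zero, coeff_X_pow_mul_of_le _ h.le]
          obtain ⟨j', rfl⟩ := Nat.exists_eq_add_of_le (show σ.1 ≤ t by omega)
          refine K.mul_mem ((ih j' (by omega)).2 σ hσ htS (by omega) htq) ?_
          refine (IsUnitBelow.mul (t := j - j' + 1) (IsUnitBelow.prod_pow fun i _ _ =>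
            (hub i).mono (by omega)) (IsUnitBelow.prod_pow fun s hs hes => hGu s hs _ ?_)).2 _
              (by omega)
          -- A generator `s` that occurs in order `t` satisfies `s ≤ t`, so only coefficients of `G
          -- s` below `q` are used.
          have h6 : e (σ.1 + j') s * s ≤ σ.1 + j' := by
            conv_rhs => rw [hwe _ htS htq]
            exact (Finset.single_le_sum (f := fun s => e (σ.1 + j') s * s)
              (fun _ _ => Nat.zero_le _) hs).trans (Nat.le_add_left _ _)
          have h7 : s ≤ e (σ.1 + j') s * s := Nat.le_mul_of_pos_left _ (Nat.pos_of_ne_zero hes)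
          omega
        · rw [if_pos rfl, coeff_X_pow_mul_of_le _ le_rfl, Nat.sub_self,
            PowerSeries.coeff_zero_eq_constantCoeff_apply,
            (IsUnitBelow.mul (K := K) (t := 0) (IsUnitBelow.prod_pow fun i _ _ =>
              (hub i).mono (by omega)) (IsUnitBelow.prod_pow fun s hs _ => hGu s hs 0 (by
                have := (Finset.mem_filter.1 hs).2; omega))).1, mul_one, sub_self]
          exact K.zero_mem
        · rw [if_neg (by omega), PowerSeries.coeff_X_pow_mul', if_neg (by omega), mul_zero, sub_zero]
          exact K.zero_mem
      have h5 := K.sub_mem (K.add_mem h4 h3) h2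
      convert h5 using 1
      rw [h1]
      simp only [sub_mul, Finset.sum_sub_distrib]
      ring
    have hspan : ∀ v ∈ activeSpan S I ref q j,
        ∑ i, (v i : L) * PowerSeries.coeff j (u i) ∈ K := by
      intro v hv
      induction hv using Submodule.span_induction with
      | mem v hv =>
        obtain ⟨σ, hσ, rfl⟩ := Finset.mem_image.1 (Finset.mem_coe.1 hv)
        obtain ⟨hσ, hσS, hσq⟩ := Finset.mem_filter.1 hσ
        have := hsyz σ hσ hσq
        rw [if_neg hσS, sub_zero] at this
        simpa [syzygyVector, diff] using this
      | zero => simp [K.zero_mem]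
      | add v v' _ _ h h' =>
        have := K.add_mem h h'
        rw [← Finset.sum_add_distrib] at this
        simpa [add_mul] using this
      | smul a v _ h =>
        have ha : (a : L) ∈ K := SubfieldClass.ratCast_mem K a
        have := K.mul_mem ha h
        rw [Finset.mul_sum] at this
        simpa [mul_assoc] using this
    -- Since `uF i.succ = F 0 * u i`, the `j`-th coefficients of `uF i.succ` and `u i` differ by
    -- that of `F 0` and terms of lower weight.
    have hnon : ∀ i, i ∉ E j → PowerSeries.coeff j (u i) ∈ K := by
      intro i hi
      have h1 := hF i j (by omega) hi
      rw [huF, coeff_X_pow_mul_of_le _ (Nat.le_add_right _ _), Nat.add_sub_cancel_left, hFu] at h1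
      have h2 := IsUnitBelow.coeff_mul_sub_mem (K := K) hj
        (⟨hF0c, fun r _ => hF0 r⟩ : IsUnitBelow K j (F 0)) (hub i)
      have := K.sub_mem (K.sub_mem h1 h2) (hF0 j)
      convert this using 1
      ring
    have hall : ∀ i, PowerSeries.coeff j (u i) ∈ K := by
      intro i
      by_cases hi : i ∈ E j
      · obtain ⟨v, hv, hvi, hv0⟩ := hE j i hi
        have h1 := hspan v hv
        rw [← Finset.add_sum_erase _ _ (Finset.mem_univ i), hvi, Rat.cast_one, one_mul] at h1
        have h2 : ∑ i' ∈ Finset.univ.erase i, (v i' : L) * PowerSeries.coeff j (u i') ∈ K := by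
          refine K.sum_mem fun i' hi' => ?_
          by_cases hi'E : i' ∈ E j
          · rw [hv0 i' hi'E (Finset.ne_of_mem_erase hi'), Rat.cast_zero, zero_mul]
            exact K.zero_mem
          · exact K.mul_mem (SubfieldClass.ratCast_mem K _) (hnon i' hi'E)
        have := K.sub_mem h1 h2
        rwa [add_sub_cancel_right] at this
      · exact hnon i hi
    refine ⟨hall, fun σ hσ hσS _ hσq => ?_⟩
    have h1 := hsyz σ hσ hσq
    rw [if_pos hσS] at h1
    have h2 : ∑ i, ((σ.2 i : L) - ref σ.1 i) * PowerSeries.coeff j (u i) ∈ K :=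
      K.sum_mem fun i _ => K.mul_mem (K.sub_mem (natCast_mem K _) (natCast_mem K _)) (hall i)
    have := K.sub_mem h2 h1
    rwa [sub_sub_cancel] at this
  refine Fin.cases (hF0 r) (fun i => ?_) l
  by_cases hr : k i.succ ≤ r
  · rw [huF, coeff_X_pow_mul_of_le _ hr, hFu]
    rw [PowerSeries.coeff_mul]
    exact K.sum_mem fun m _ => K.mul_mem (hF0 _) ((key _).1 i)
  · rw [(hN.monic i.succ).1 r (by omega)]
    exact K.zero_mem

end Elimination

/-! ### Positions where the pivots can be placed. -/

section Pivots

variable {n : ℕ} {S : AddSubmonoid ℕ} {k : Fin (n + 1) → ℕ} {I : ℕ → Finset (Fin n → ℕ)}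
  {ref : ℕ → Fin n → ℕ}

lemma sum_mul_eq_zero_of_mem_activeSpan
    (hY : ∀ σ ∈ syzygies S I ref, value k σ.2 = σ.1 ∧ value k (ref σ.1) = σ.1) {q j : ℕ}
    {v : Fin n → ℚ} (hv : v ∈ activeSpan S I ref q j) : ∑ i, v i * (k i.succ : ℚ) = 0 := by
  induction hv using Submodule.span_induction with
  | mem x hx =>
    obtain ⟨σ, hσ, rfl⟩ := Finset.mem_image.1 (Finset.mem_coe.1 hx)
    obtain ⟨h1, h2⟩ := hY σ (Finset.mem_filter.1 hσ).1
    have h : (value k σ.2 : ℚ) = value k (ref σ.1) := by rw [h1, h2]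
    simp only [value, Nat.cast_sum, Nat.cast_mul] at h
    simp only [syzygyVector, diff, sub_mul, Finset.sum_sub_distrib, h, sub_self]
  | zero => simp
  | add x y _ _ hx hy => simp [add_mul, Finset.sum_add_distrib, hx, hy]
  | smul c x _ hx => simp [mul_assoc, ← Finset.mul_sum, hx]

lemma add_mem_of_value_add_mem (hkS : ∀ l, k l ∈ S) {v : Fin n → ℕ} {i : Fin n} {j : ℕ}
    (hv : v i ≠ 0) (hi : k i.succ + j ∈ S) : value k v + j ∈ S := by
  have h : v = (v - Pi.single i 1) + Pi.single i 1 :=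
    (tsub_add_cancel_of_le (single_le_of_le (Nat.one_le_iff_ne_zero.2 hv))).symm
  rw [h, value_add, value_single, one_mul, add_assoc]
  refine S.add_mem (S.sum_mem fun l _ => ?_) hi
  rw [← smul_eq_mul]
  exact S.nsmul_mem (hkS _) _

/-- If `k_i` occurs in a decomposition of `s` and `k_i + j ∈ S`, then `s + j ∈ S`, so the pair is
not active. Hence pivots sit only at gaps, away from the entries of `k`. -/
lemma apply_eq_zero_of_mem_activeSpan (hkS : ∀ l, k l ∈ S)
    (hY : ∀ σ ∈ syzygies S I ref, value k σ.2 = σ.1 ∧ value k (ref σ.1) = σ.1) {q j : ℕ}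
    {v : Fin n → ℚ} (hv : v ∈ activeSpan S I ref q j) {i : Fin n} (hi : k i.succ + j ∈ S) :
    v i = 0 := by
  induction hv using Submodule.span_induction with
  | mem x hx =>
    obtain ⟨σ, hσ, rfl⟩ := Finset.mem_image.1 (Finset.mem_coe.1 hx)
    obtain ⟨hσ, hgap, -⟩ := Finset.mem_filter.1 hσ
    obtain ⟨h1, h2⟩ := hY σ hσ
    have h3 : σ.2 i = 0 := by
      by_contra h
      exact hgap (h1 ▸ add_mem_of_value_add_mem hkS h hi)
    have h4 : ref σ.1 i = 0 := by
      by_contra h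
      have := add_mem_of_value_add_mem hkS h hi
      rw [h2] at this
      exact hgap this
    simp [syzygyVector, diff, h3, h4]
  | zero => rfl
  | add x y _ _ hx hy => simp [hx, hy]
  | smul c x _ hx => simp [hx]

lemma exists_activeSpan_pivots (hS : {r : ℕ | r ∉ S}.Finite) (hk : StrictMono k)
    (hkS : ∀ l, k l ∈ S) {d : ℕ} (hd : 2 * genus S - 2 ≤ d)
    (hY : ∀ σ ∈ syzygies S I ref, value k σ.2 = σ.1 ∧ value k (ref σ.1) = σ.1) (q j : ℕ) :
    ∃ E : Finset (Fin n), (∀ i ∈ E, k i.succ + j ∉ S ∧ k i.succ + j ≤ d) ∧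
      E.card = Module.finrank ℚ (activeSpan S I ref q j) ∧
      ∀ i ∈ E, ∃ v ∈ activeSpan S I ref q j, v i = 1 ∧ ∀ i' ∈ E, i' ≠ i → v i' = 0 := by
  obtain ⟨E, hEU, hcard, hE⟩ := exists_pivots (activeSpan S I ref q j)
    (Finset.univ.filter fun i => k i.succ + j ∉ S ∧ k i.succ + j ≤ d) (by
      intro v hv hU
      -- As `d ≥ 2g - 2`, the only gap that can exceed `d` is `2g - 1`. A vector supported beyond
      -- degree `d` then has at most one nonzero entry, which the relation `∑ v_i k_i = 0` excludes.
      have hgap : ∀ i, v i ≠ 0 → k i.succ + j = 2 * genus S - 1 := by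
        intro i hi
        have h1 : k i.succ + j ∉ S := fun h => hi (apply_eq_zero_of_mem_activeSpan hkS hY hv h)
        have h2 : d < k i.succ + j := by
          by_contra h
          exact hi (hU i (by simpa using ⟨h1, not_lt.1 h⟩))
        have := lt_two_mul_genus hS h1
        omega
      by_contra hne
      obtain ⟨i, hi⟩ := Function.ne_iff.1 hne
      have hsum := sum_mul_eq_zero_of_mem_activeSpan hY hv
      rw [Finset.sum_eq_single i (fun i' _ hi' => ?_) (by simp)] at hsum
      · rcases mul_eq_zero.1 hsum with h | h
        · exact hi h
        · exact (succ_pos_of_strictMono hk i).ne' (by exact_mod_cast h)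
      · by_cases h : v i' = 0
        · rw [h, zero_mul]
        · refine absurd (Fin.succ_injective _ (hk.injective ?_)) hi'
          have := hgap i hi
          have := hgap i' h
          omega)
  exact ⟨E, fun i hi => (Finset.mem_filter.1 (hEU hi)).2, hcard, hE⟩

end Pivots

/-! ### Passing from families of normal forms to a residue field. -/

section Transfer

variable {Z L : Type} [Field L] [Algebra ℂ L]

/-- The ring homomorphism from families of power series induced by a homomorphism on families of
coefficients. -/
def familyMap (π : (Z → ℂ) →ₐ[ℂ] L) : (Z → ℂ⟦X⟧) →+* L⟦X⟧ where
  toFun h := PowerSeries.mk fun r => π fun z => PowerSeries.coeff r (h z)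
  map_one' := by
    ext r
    rw [PowerSeries.coeff_mk, PowerSeries.coeff_one]
    split_ifs with hr
    · rw [← map_one π]; congr 1; ext z; simp [hr]
    · rw [← map_zero π]; congr 1; ext z; simp [PowerSeries.coeff_one, hr]
  map_zero' := by
    ext r
    rw [PowerSeries.coeff_mk, map_zero, ← map_zero π]; congr 1
  map_add' h h' := by
    ext r
    simp only [PowerSeries.coeff_mk, map_add, Pi.add_apply]
    rw [← map_add]; rfl
  map_mul' h h' := by
    ext r
    rw [PowerSeries.coeff_mul]
    simp only [PowerSeries.coeff_mk, Pi.mul_apply, PowerSeries.coeff_mul, ← map_mul]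
    rw [← map_sum]
    congr 1
    ext z
    simp

@[simp] lemma coeff_familyMap (π : (Z → ℂ) →ₐ[ℂ] L) (h : Z → ℂ⟦X⟧) (r : ℕ) :
    PowerSeries.coeff r (familyMap π h) = π fun z => PowerSeries.coeff r (h z) := by
  change PowerSeries.coeff r (PowerSeries.mk fun r => π fun z => PowerSeries.coeff r (h z)) = _
  rw [PowerSeries.coeff_mk]

lemma familyMap_C (π : (Z → ℂ) →ₐ[ℂ] L) (b : Z → ℂ) :
    familyMap π (fun z => PowerSeries.C (b z)) = PowerSeries.C (π b) := by
  ext r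
  rw [coeff_familyMap, PowerSeries.coeff_C]
  split_ifs with hr
  · congr 1; ext z; simp [hr]
  · rw [← map_zero π]; congr 1; ext z; simp [PowerSeries.coeff_C, hr]

lemma familyMap_X (π : (Z → ℂ) →ₐ[ℂ] L) :
    familyMap π (fun _ => PowerSeries.X) = PowerSeries.X := by
  ext r
  simp only [coeff_familyMap, PowerSeries.coeff_X]
  split_ifs with hr
  · exact map_one π
  · exact map_zero π

variable {n : ℕ}

lemma familyMap_monom (π : (Z → ℂ) →ₐ[ℂ] L) (f : Z → Fin n → ℂ⟦X⟧) (v : Fin n → ℕ) :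
    familyMap π (fun z => monom (f z) v) = monom (fun i => familyMap π fun z => f z i) v := by
  simp only [monom, ← map_pow, ← map_prod]
  congr 1
  ext z : 1
  simp

lemma familyMap_mixedMonom (π : (Z → ℂ) →ₐ[ℂ] L) (f : Z → Fin n → ℂ⟦X⟧) (T : Finset ℕ)
    (G : Z → ℕ → ℂ⟦X⟧) (w : Fin n → ℕ) (e : ℕ → ℕ) :
    familyMap π (fun z => mixedMonom (f z) T (G z) w e) =
      mixedMonom (fun i => familyMap π fun z => f z i) T (fun s => familyMap π fun z => G z s)
        w e := by
  simp only [mixedMonom]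
  rw [← familyMap_monom]
  simp only [← map_pow, ← map_prod, ← map_mul]
  congr 1
  ext z : 1
  simp

lemma IsMonicOfOrder.familyMap (π : (Z → ℂ) →ₐ[ℂ] L) {h : Z → ℂ⟦X⟧} {s : ℕ}
    (hh : ∀ z, IsMonicOfOrder (h z) s) : IsMonicOfOrder (familyMap π h) s := by
  refine ⟨fun r hr => ?_, ?_⟩
  · rw [coeff_familyMap, funext fun z => (hh z).1 r hr]; exact map_zero π
  · rw [coeff_familyMap, funext fun z => (hh z).2]; exact map_one π

lemma IsNormalForm.familyMap {d q : ℕ} {S : AddSubmonoid ℕ} {k : Fin (n + 1) → ℕ}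
    {Y : Finset (Σ _ : ℕ, Fin n → ℕ)} {ref : ℕ → Fin n → ℕ}
    {w : ℕ → Fin n → ℕ} {e : ℕ → ℕ → ℕ} (π : (Z → ℂ) →ₐ[ℂ] L)
    {F : Z → Fin (n + 1) → ℂ⟦X⟧} {f : Z → Fin n → ℂ⟦X⟧} {G : Z → ℕ → ℂ⟦X⟧}
    {c : Z → (Σ _ : ℕ, Fin n → ℕ) → ℕ → ℂ}
    (hN : ∀ z, IsNormalForm d q S k Y ref w e (F z) (f z) (G z) (c z)) :
    IsNormalForm d q S k Y ref w e (fun l => Severi.familyMap π fun z => F z l)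
      (fun i => Severi.familyMap π fun z => f z i) (fun s => Severi.familyMap π fun z => G z s)
      (fun σ u => π fun z => c z σ u) where
  monic l := .familyMap π fun z => (hN z).monic l
  echelon l l' h := by
    rw [coeff_familyMap, funext fun z => (hN z).echelon l l' h]; exact map_zero π
  degree l r h := by
    rw [coeff_familyMap, funext fun z => (hN z).degree l r h]; exact map_zero π
  dehomogenize i := by
    rw [← map_mul]
    congr 1
    exact funext fun z => (hN z).dehomogenize i
  generator_monic s hs := .familyMap π fun z => (hN z).generator_monic s hs
  generator_reduced s hs u hu h h' := by
    rw [coeff_familyMap, funext fun z => (hN z).generator_reduced s hs u hu h h']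
    exact map_zero π
  syzygy σ hσ r hr := by
    simp only [← familyMap_monom, ← familyMap_mixedMonom, coeff_familyMap, ← map_mul, ← map_sum,
      ← map_add]
    congr 1
    ext z
    simpa using (hN z).syzygy σ hσ r hr

end Transfer

/-- Translating back by `p ∈ K` keeps a polynomial over `K`. -/
lemma mem_of_coeff_translate_mem {L : Type} [Field L] {K : Subfield L} {d : ℕ}
    (b : Fin (d + 1) → L) {p : L} (hp : p ∈ K)
    (h : ∀ r, PowerSeries.coeff r (∑ j : Fin (d + 1), PowerSeries.C (b j) *
      (PowerSeries.C p + PowerSeries.X) ^ (j : ℕ)) ∈ K) (j : Fin (d + 1)) : b j ∈ K := by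
  set P : Polynomial L := ∑ j : Fin (d + 1), Polynomial.C (b j) *
    (Polynomial.C p + Polynomial.X) ^ (j : ℕ) with hP
  have hcoe : (P : L⟦X⟧) = ∑ j : Fin (d + 1), PowerSeries.C (b j) *
      (PowerSeries.C p + PowerSeries.X) ^ (j : ℕ) := by
    rw [hP, ← Polynomial.coeToPowerSeries.ringHom_apply, map_sum]
    simp
  have hPK : P ∈ Polynomial.lifts K.subtype := by
    rw [Polynomial.lifts_iff_coeff_lifts]
    intro r
    rw [← Polynomial.coeff_coe, hcoe]
    exact ⟨⟨_, h r⟩, rfl⟩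
  obtain ⟨Q, hQ⟩ := (Polynomial.mem_lifts _).1 hPK
  have hcomp : (Q.comp (Polynomial.X - Polynomial.C ⟨p, hp⟩)).map K.subtype =
      ∑ j : Fin (d + 1), Polynomial.C (b j) * Polynomial.X ^ (j : ℕ) := by
    rw [Polynomial.map_comp, hQ, hP, Polynomial.sum_comp]
    simp
  have hcoeff : Polynomial.coeff (∑ j : Fin (d + 1), Polynomial.C (b j) * Polynomial.X ^ (j : ℕ))
      (j : ℕ) = b j := by
    rw [Polynomial.finsetSum_coeff, Finset.sum_eq_single j]
    · simp
    · intro j' _ hj'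
      simp [Polynomial.coeff_X_pow, Fin.val_inj, Ne.symm hj']
    · simp
  rw [← hcoeff, ← hcomp, Polynomial.coeff_map]
  exact Subtype.property _


/-! ### Numbers of free, eliminated and auxiliary coefficients. -/

section Count

variable {n d q : ℕ} {S : AddSubmonoid ℕ} {k : Fin (n + 1) → ℕ}

/-- The positions of the coefficients of a reduced echelon basis with pivots `k` that are not
determined by the echelon form. -/
def freePositions (d : ℕ) (k : Fin (n + 1) → ℕ) : Finset (Fin (n + 1) × ℕ) :=
  (Finset.univ ×ˢ Finset.range (d + 1)).filter fun x => k x.1 < x.2 ∧ x.2 ∉ Set.range k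

/-- The positions of the coefficients that are determined by the syzygies. -/
def pivotPositions (k : Fin (n + 1) → ℕ) (q : ℕ) (E : ℕ → Finset (Fin n)) :
    Finset (Fin (n + 1) × ℕ) :=
  ((Finset.Icc 1 q).sigma E).image fun x => (Fin.succ x.2, k (Fin.succ x.2) + x.1)

/-- The positions of the free coefficients of the missing generators. -/
def generatorPositions (S : AddSubmonoid ℕ) (k : Fin (n + 1) → ℕ) (q : ℕ) : Finset (Σ _ : ℕ, ℕ) :=
  ((missingGenerators S k).filter (· < q)).sigma fun s =>
    (Finset.range q).filter fun r => s < r ∧ r ∉ S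

lemma card_generatorPositions : (generatorPositions S k q).card =
    ∑ s ∈ (missingGenerators S k).filter (· < q), rhoBelow S q s :=
  Finset.card_sigma _ _

lemma card_pivotPositions (E : ℕ → Finset (Fin n)) :
    (pivotPositions k q E).card = ∑ j ∈ Finset.Icc 1 q, (E j).card := by
  rw [pivotPositions, Finset.card_image_of_injective, Finset.card_sigma]
  rintro ⟨j, i⟩ ⟨j', i'⟩ h
  rw [Prod.mk.injEq] at h
  obtain rfl := Fin.succ_injective _ h.1
  have : j = j' := by have := h.2; dsimp only at this; omega
  rw [this]

lemma pivotPositions_subset (hkS : ∀ l, k l ∈ S) {E : ℕ → Finset (Fin n)}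
    (hE : ∀ j, ∀ i ∈ E j, k i.succ + j ∉ S ∧ k i.succ + j ≤ d) :
    pivotPositions k q E ⊆ freePositions d k := by
  intro x hx
  obtain ⟨⟨j, i⟩, hji, rfl⟩ := Finset.mem_image.1 hx
  obtain ⟨hj, hi⟩ := Finset.mem_sigma.1 hji
  have hj := (Finset.mem_Icc.1 hj).1
  obtain ⟨h1, h2⟩ := hE j i hi
  simp only [freePositions, Finset.mem_filter, Finset.mem_product, Finset.mem_univ, true_and,
    Finset.mem_range]
  exact ⟨Nat.lt_succ_of_le h2, by dsimp only at hj; omega, fun ⟨l, hl⟩ => h1 (hl ▸ hkS l)⟩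

lemma card_freePositions (hk : StrictMono k) (hkd : ∀ l, k l ≤ d) :
    ((freePositions d k).card : ℤ) = ∑ l : Fin (n + 1), ((d : ℤ) - k l - (n - (l : ℕ))) := by
  have h1 : (freePositions d k).card = ∑ l : Fin (n + 1),
      ((Finset.Ioc (k l) d).filter fun r => r ∉ Set.range k).card := by
    rw [← Finset.card_sigma]
    refine Finset.card_bij (fun x _ => ⟨x.1, x.2⟩) (fun x hx => ?_) (fun x _ y _ h => ?_)
      fun x hx => ⟨(x.1, x.2), ?_, rfl⟩
    · simp only [freePositions, Finset.mem_filter, Finset.mem_product, Finset.mem_range,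
        Finset.mem_sigma, Finset.mem_univ, Finset.mem_Ioc, true_and] at hx ⊢
      exact ⟨⟨hx.2.1, Nat.lt_succ_iff.1 hx.1⟩, hx.2.2⟩
    · obtain ⟨l, r⟩ := x
      obtain ⟨l', r'⟩ := y
      simpa using h
    · simp only [freePositions, Finset.mem_filter, Finset.mem_product, Finset.mem_range,
        Finset.mem_sigma, Finset.mem_univ, Finset.mem_Ioc, true_and] at hx ⊢
      exact ⟨Nat.lt_succ_iff.2 hx.1.2, hx.1.1, hx.2⟩
  rw [h1, Nat.cast_sum]
  refine Finset.sum_congr rfl fun l _ => ?_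
  have h2 := Finset.card_filter_add_card_filter_not (s := Finset.Ioc (k l) d)
    (fun r => r ∈ Set.range k)
  -- The positions excluded by the echelon form are the `n - l` entries of `k` above `k l`.
  have h3 : ((Finset.Ioc (k l) d).filter fun r => r ∈ Set.range k) =
      (Finset.Ioi l).image k := by
    ext r
    simp only [Finset.mem_filter, Finset.mem_Ioc, Finset.mem_image, Finset.mem_Ioi]
    constructor
    · rintro ⟨⟨h, -⟩, l', rfl⟩
      exact ⟨l', hk.lt_iff_lt.1 h, rfl⟩
    · rintro ⟨l', h, rfl⟩
      exact ⟨⟨hk h, hkd l'⟩, l', rfl⟩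
  rw [h3, Finset.card_image_of_injective _ hk.injective, Fin.card_Ioi, Nat.card_Ioc] at h2
  have := hkd l
  have := l.2
  omega

end Count

/-! ### The codimension bound in one chart, and the conclusion. -/

section Chart

variable {n d q : ℕ} {S : AddSubmonoid ℕ} {k : Fin (n + 1) → ℕ} {I : ℕ → Finset (Fin n → ℕ)}
  {ref : ℕ → Fin n → ℕ} {w : ℕ → Fin n → ℕ} {e : ℕ → ℕ → ℕ}

/-- Every coefficient outside the listed positions is `0` or `1` by the shape of a normal form, or
is a pivot and therefore eliminated. -/
theorem IsNormalForm.coeff_mem_of_positions {L : Type} [Field L] [CharZero L] {K : Subfield L}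
    {F : Fin (n + 1) → L⟦X⟧} {f : Fin n → L⟦X⟧} {G : ℕ → L⟦X⟧}
    {c : (Σ _ : ℕ, Fin n → ℕ) → ℕ → L} (hk0 : k 0 = 0)
    (hN : IsNormalForm d q S k (syzygies S I ref) ref w e F f G c)
    (hY : ∀ σ ∈ syzygies S I ref, value k σ.2 = σ.1 ∧ value k (ref σ.1) = σ.1)
    (hwe : ∀ u ∈ S, u < q →
      u = value k (w u) + ∑ s ∈ (missingGenerators S k).filter (· < q), e u s * s)
    {E : ℕ → Finset (Fin n)}
    (hE : ∀ j, ∀ i ∈ E j, ∃ v ∈ activeSpan S I ref q j, v i = 1 ∧ ∀ i' ∈ E j, i' ≠ i → v i' = 0)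
    (hF : ∀ x ∈ freePositions d k \ pivotPositions k q E, PowerSeries.coeff x.2 (F x.1) ∈ K)
    (hG : ∀ x ∈ generatorPositions S k q, PowerSeries.coeff x.2 (G x.1) ∈ K)
    (l : Fin (n + 1)) (r : ℕ) : PowerSeries.coeff r (F l) ∈ K := by
  have hmem : ∀ l r, (l, r) ∉ pivotPositions k q E → PowerSeries.coeff r (F l) ∈ K := by
    intro l r hlr
    by_cases hd : d < r
    · rw [hN.degree l r hd]; exact K.zero_mem
    rcases lt_trichotomy r (k l) with h | rfl | h
    · rw [(hN.monic l).1 r h]; exact K.zero_mem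
    · rw [(hN.monic l).2]; exact K.one_mem
    by_cases hr : r ∈ Set.range k
    · obtain ⟨l', rfl⟩ := hr
      rw [hN.echelon l l' fun hl => h.ne (congrArg k hl)]; exact K.zero_mem
    · refine hF (l, r) (Finset.mem_sdiff.2 ⟨?_, hlr⟩)
      simp only [freePositions, Finset.mem_filter, Finset.mem_product, Finset.mem_univ, true_and,
        Finset.mem_range]
      exact ⟨by omega, h, hr⟩
  refine hN.coeff_mem hk0 hY hwe hE (fun r => hmem 0 r fun h => ?_) (fun i j hj hi => hmem _ _
    fun h => ?_) (fun s hs r hr => ?_) l r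
  · obtain ⟨x, -, hx⟩ := Finset.mem_image.1 h
    exact Fin.succ_ne_zero _ (Prod.mk.inj hx).1
  · obtain ⟨⟨j', i'⟩, hx, hx'⟩ := Finset.mem_image.1 h
    obtain ⟨h1, h2⟩ := Prod.mk.inj hx'
    obtain rfl := Fin.succ_injective _ h1
    obtain rfl : j' = j := by dsimp only at h2; omega
    exact hi (Finset.mem_sigma.1 hx).2
  · rcases lt_trichotomy r s with h | rfl | h
    · rw [(hN.generator_monic s hs).1 r h]; exact K.zero_mem
    · rw [(hN.generator_monic r hs).2]; exact K.one_mem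
    by_cases hrS : r ∈ S
    · rw [hN.generator_reduced s hs r hrS h hr]; exact K.zero_mem
    · exact hG ⟨s, r⟩ (Finset.mem_sigma.2 ⟨hs, Finset.mem_filter.2
        ⟨Finset.mem_range.2 hr, h, hrS⟩⟩)

theorem card_le_codim_add_of_chart (hk0 : k 0 = 0)
    (hY : ∀ σ ∈ syzygies S I ref, value k σ.2 = σ.1 ∧ value k (ref σ.1) = σ.1)
    (hwe : ∀ u ∈ S, u < q →
      u = value k (w u) + ∑ s ∈ (missingGenerators S k).filter (· < q), e u s * s)
    {E : ℕ → Finset (Fin n)}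
    (hE : ∀ j, ∀ i ∈ E j, ∃ v ∈ activeSpan S I ref q j, v i = 1 ∧ ∀ i' ∈ E j, i' ≠ i → v i' = 0)
    (ε : Bool) (Z : Set (Fin (n + 1) × Fin (d + 1) → ℂ))
    (hZ : ∀ a ∈ Z, ∃ (p : ℂ) (g : Fin (n + 1) → Fin (n + 1) → ℂ)
      (F : Fin (n + 1) → ℂ⟦X⟧) (f : Fin n → ℂ⟦X⟧) (G : ℕ → ℂ⟦X⟧)
      (c : (Σ _ : ℕ, Fin n → ℕ) → ℕ → ℂ),
      (∀ i, chartSection ε a p i = ∑ l, PowerSeries.C (g i l) * F l) ∧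
      IsNormalForm d q S k (syzygies S I ref) ref w e F f G c) :
    (((n + 1) * (d + 1) : ℕ) : ℕ∞) ≤ codim Z + ((1 + (n + 1) * (n + 1) +
      (freePositions d k \ pivotPositions k q E).card + (generatorPositions S k q).card : ℕ)) := by
  have hcard : Fintype.card (Fin (n + 1) × Fin (d + 1)) = (n + 1) * (d + 1) := by simp
  rw [← hcard]
  refine card_le_codim_add Z _ fun L _ _ π => ?_
  have : CharZero L := charZero_of_injective_algebraMap (algebraMap ℂ L).injective
  -- An arbitrary choice of normal forms suffices, because `π` is defined on all functions on `Z`.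
  choose p g F f G c hg hN using fun z : Z => hZ z.1 z.2
  have hN' := IsNormalForm.familyMap π hN
  -- The parameters: the point, the change of basis, the surviving section coefficients, and the
  -- coefficients of the `G s` at gaps.
  let ι := Unit ⊕ (Fin (n + 1) × Fin (n + 1)) ⊕ ↥(freePositions d k \ pivotPositions k q E) ⊕
    ↥(generatorPositions S k q)
  let y : ι → L := Sum.elim (fun _ => π p) (Sum.elim (fun x => π fun z => g z x.1 x.2)
    (Sum.elim (fun x => PowerSeries.coeff x.1.2 (familyMap π fun z => F z x.1.1))
      fun x => PowerSeries.coeff x.1.2 (familyMap π fun z => G z x.1.1)))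
  refine ⟨ι, inferInstance, y, ?_, ?_⟩
  · simp only [ι, Fintype.card_sum, Fintype.card_prod, Fintype.card_fin, Fintype.card_unit,
      Fintype.card_coe]
    omega
  set K := (IntermediateField.adjoin ℂ (Set.range y)).toSubfield
  have hy : ∀ i, y i ∈ K := fun i => IntermediateField.subset_adjoin ℂ _ ⟨i, rfl⟩
  have hFK := hN'.coeff_mem_of_positions (K := K) hk0 hY hwe hE
    (fun x hx => hy (.inr (.inr (.inl ⟨x, hx⟩)))) (fun x hx => hy (.inr (.inr (.inr ⟨x, hx⟩))))
  rintro ⟨i, j⟩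
  have hchart : ∑ j : Fin (d + 1), PowerSeries.C (π fun z => z.1 (i, chartPerm d ε j)) *
      (PowerSeries.C (π p) + PowerSeries.X) ^ (j : ℕ) =
      ∑ l, PowerSeries.C (π fun z => g z i l) * familyMap π fun z => F z l := by
    simp only [← familyMap_C, ← familyMap_X π, ← map_add, ← map_pow, ← map_mul, ← map_sum]
    congr 1
    ext z : 1
    simpa [chartSection] using hg z i
  have hb := mem_of_coeff_translate_mem (K := K) (fun j => π fun z => z.1 (i, chartPerm d ε j))
    (hy (.inl ())) (by
      intro r
      have : y (.inl ()) = π p := rfl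
      rw [this, hchart, map_sum]
      refine K.sum_mem fun l _ => ?_
      rw [PowerSeries.coeff_C_mul]
      exact K.mul_mem (hy (.inr (.inl (i, l)))) (hFK l r)) ((chartPerm d ε).symm j)
  rw [Equiv.apply_symm_apply] at hb
  exact hb

end Chart

theorem expectedCodim_le {n d : ℕ} {S : AddSubmonoid ℕ} (hS : {r : ℕ | r ∉ S}.Finite)
    {k : Fin (n + 1) → ℕ} (hk0 : k 0 = 0) (hk : StrictMono k) (hd : 2 * genus S - 2 ≤ d)
    (hne : (stratum d S k).Nonempty) {I : ℕ → Finset (Fin n → ℕ)} (hI : Unlinked k I)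
    {ref : ℕ → Fin n → ℕ} (href : ∀ s, (I s).Nonempty → ref s ∈ I s) {c : ℕ}
    (hc : codim (stratum d S k) = (c : ℕ∞)) : expectedCodim S k I ref ≤ (c : ℤ) := by
  obtain ⟨q, hq, hcut⟩ := exists_cutoff hS hI hk href
  have hrank := sum_rhoBelow_le hS hI href hq
  have hY : ∀ σ ∈ syzygies S I ref, value k σ.2 = σ.1 ∧ value k (ref σ.1) = σ.1 := fun σ hσ =>
    ⟨hI.value_eq (mem_syzygies.1 hσ).2.2, hI.value_eq (ref_mem href hσ)⟩
  choose! w e hwe using fun u hu huq => exists_generation (S := S) hk0 hq u hu huq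
  obtain ⟨a₀, ha₀⟩ := hne
  have hkl := (exists_normalForm hk0 hk hY hwe ha₀).1
  choose E hEd hEcard hE using exists_activeSpan_pivots hS hk (fun l => (hkl l).1) hd hY q
  -- The stratum is split according to the chart that provides a normal form.
  set W := fun ε => {a ∈ stratum d S k | ∃ (p : ℂ) (g : Fin (n + 1) → Fin (n + 1) → ℂ)
      (F : Fin (n + 1) → ℂ⟦X⟧) (f : Fin n → ℂ⟦X⟧) (G : ℕ → ℂ⟦X⟧)
      (c : (Σ _ : ℕ, Fin n → ℕ) → ℕ → ℂ),
      (∀ i, chartSection ε a p i = ∑ l, PowerSeries.C (g i l) * F l) ∧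
      IsNormalForm d q S k (syzygies S I ref) ref w e F f G c}
  have hW : stratum d S k = W false ∪ W true := by
    ext a
    constructor
    · intro ha
      obtain ⟨-, ε, h⟩ := exists_normalForm hk0 hk hY hwe ha
      cases ε
      · exact Or.inl ⟨ha, h⟩
      · exact Or.inr ⟨ha, h⟩
    · rintro (h | h) <;> exact h.1
  have hbound := fun ε => card_le_codim_add_of_chart hk0 hY hwe hE ε (W ε) fun a ha => ha.2
  have hmain := le_codim_union _ _ _ _ (hbound false) (hbound true)
  rw [← hW, hc] at hmain
  have hmain : (n + 1) * (d + 1) ≤ c + (1 + (n + 1) * (n + 1) +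
      (freePositions d k \ pivotPositions k q E).card + (generatorPositions S k q).card) := by
    exact_mod_cast hmain
  have hsub := Finset.card_sdiff_add_card_eq_card
    (pivotPositions_subset (d := d) (q := q) (fun l => (hkl l).1) hEd)
  rw [card_pivotPositions, Finset.sum_congr rfl fun j _ => hEcard j] at hsub
  rw [card_generatorPositions] at hmain
  have hfree := card_freePositions hk fun l => (hkl l).2
  rw [Fin.sum_univ_succ, hk0] at hfree
  -- With the term `d - n` from `l = 0`, the free positions number `(n+1)(d-n) - ∑ (k_i - i)`. Since
  -- `(n+1)(d+1) - (n+1)² = (n+1)(d-n)`, what remains is `∑ (k_i - i) - 1`, plus the pivots, minus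
  -- the auxiliary coefficients.
  have hsum : ∑ i : Fin n, ((d : ℤ) - k i.succ - (n - (i.succ : ℕ))) =
      n * (d - n) - ∑ i : Fin n, ((k i.succ : ℤ) - ((i : ℤ) + 1)) := by
    rw [eq_sub_iff_add_eq, ← Finset.sum_add_distrib]
    have : ∀ i : Fin n, ((d : ℤ) - k i.succ - (n - (i.succ : ℕ))) +
        ((k i.succ : ℤ) - ((i : ℤ) + 1)) = d - n := fun i => by
      rw [Fin.val_succ]; push_cast; ring
    rw [Finset.sum_congr rfl fun i _ => this i]
    simp [mul_sub]
  rw [hsum] at hfree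
  rw [expectedCodim, ← Nat.cast_sum]
  zify at hmain hsub hcut hrank ⊢
  simp only [Fin.val_zero, Nat.cast_zero] at hfree
  linarith [mul_comm (n : ℤ) d]

end Severi

theorem theorem3p8 (n d : ℕ) (S : AddSubmonoid ℕ)
    (hS : {r : ℕ | r ∉ S}.Finite) (hg : 0 < Severi.genus S)
    (k : Fin (n + 1) → ℕ) (hk0 : k 0 = 0) (hk : StrictMono k)
    (hd : max n (2 * Severi.genus S - 2) ≤ d)
    (hne : (Severi.stratum d S k).Nonempty)
    (I : ℕ → Finset (Fin n → ℕ))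
    (hI : I = Severi.irreducibleDecompositions k ∨ Severi.IsSystemOfRepresentatives k I)
    (ref : ℕ → Fin n → ℕ) (href : ∀ s, (I s).Nonempty → ref s ∈ I s) :
    ∃ c : ℕ, Severi.codim (Severi.stratum d S k) = (c : ℕ∞) ∧
      Severi.expectedCodim S k I ref ≤ (c : ℤ) := by
  have hI' : Severi.Unlinked k I := by
    rcases hI with rfl | hI
    · exact Severi.unlinked_irreducibleDecompositions
    · exact hI.unlinked
  have hproper : MvPolynomial.vanishingIdeal ℂ (Severi.stratum d S k) ≠ ⊤ := by
    obtain ⟨a, ha⟩ := hne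
    intro h
    have h1 := MvPolynomial.mem_vanishingIdeal_iff.1 ((Ideal.eq_top_iff_one _).1 h) a ha
    simp at h1
  have hfin : Severi.codim (Severi.stratum d S k) ≠ ⊤ := Ideal.height_ne_top hproper
  obtain ⟨c, hc⟩ := ENat.ne_top_iff_exists.1 hfin
  exact ⟨c, hc.symm, Severi.expectedCodim_le hS hk0 hk ((le_max_right _ _).trans hd) hne hI' href
    hc.symm⟩

end
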